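/- **Lemma (weighted stochastic sewing).** For $S\in[0,1]$ write $[S,1]_\le=\{(s,t): S<s<t\le 1\}$ and $[S,1]^*_\le=\{(s,t): S<s<t\le 1,\ |t-s|\le S\}$. For $\mathcal A$ of one variable put $\mathcal A_{s,t}=\mathcal A_t-\mathcal A_s$, and for $A$ of two variables put $\delta A_{s,u,t}=A_{s,t}-A_{s,u}-A_{u,t}$. Let $(\Omega,\mathcal F,(\mathcal F_t)_{t\ge0},\mathbf P)$ be a filtered probability space, let $\mathbf E^s$ denote conditional expectation given $\mathcal F_s$, and let $L_p(\Omega)=L_p(\Omega;E)$ for some finite-dimensional real inner product space $E$ with its Euclidean norm (for example $E=\mathbb R$ or $\mathbb R^d$). Let $2\le p<\infty$, and let $A$ be a function from $[0,1]_\le$ to $L_p(\Omega)$ such that $A_{s,t}$ is $\mathcal F_t$-measurable for all $(s,t)\in[0,1]_\le$. Suppose that there are $\varepsilon_1,\varepsilon_2>0$, $\delta_1,\delta_2\ge0$ and $C_1,C_2\in[0,\infty)$ with $1/2+\varepsilon_1-\delta_1>0$ and $1+\varepsilon_2-\delta_2>0$ such that for all $S\in(0,1]$, all $(s,t)\in[S,1]^*_\le$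 and all $u\in(s,t)$, $$\|A_{s,t}\|_{L_p(\Omega)}\le C_1S^{-\delta_1}|t-s|^{1/2+\varepsilon_1},\qquad \|\mathbf E^s\delta A_{s,u,t}\|_{L_p(\Omega)}\le C_2S^{-\delta_2}|t-s|^{1+\varepsilon_2}.$$ Then there exists a unique $(\mathcal F_t)_{t\in[0,1]}$-adapted function $\mathcal A:[0,1]\to L_p(\Omega)$ such that $\mathcal A_0=0$, $\|\mathcal A_t\|_{L_p(\Omega)}\to0$ as $t\downarrow0$, and for every $S\in(0,1]$ there exist constants $K_1,K_2\ge 0$ such that for all $(s,t)\in[S,1]^*_\le$, $$\|\mathcal A_{s,t}-A_{s,t}\|_{L_p(\Omega)}\le K_1|t-s|^{1/2+\varepsilon_1}+K_2|t-s|^{1+\varepsilon_2},\qquad \|\mathbf E^s(\mathcal A_{s,t}-A_{s,t})\|_{L_p(\Omega)}\le K_2|t-s|^{1+\varepsilon_2}.$$ Furthermore, these bounds hold with $K_1=NC_1S^{-\delta_1}$ and $K_2=NC_2S^{-\delta_2}$, where $N$ depends only on $p,\varepsilon_1,\varepsilon_2,\delta_1,\delta_2$. Moreover, for all $S\in(0,1]$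 and $(s,t)\in[S,1]^*_\le$, $$\|\mathcal A_{s,t}\|_{L_p(\Omega)}\le N\big(C_1S^{-\delta_1}|t-s|^{1/2+\varepsilon_1}+C_2S^{-\delta_2}|t-s|^{1+\varepsilon_2}\big).$$ -/

import Mathlib

open MeasureTheory Filter Topology
open scoped NNReal ENNReal

universe u v

noncomputable section

/-- The set `[S, 1]^*_≤` of pairs `(s, t)` with `S < s < t ≤ 1` and `|t - s| ≤ S`. -/
def starPairs (S : ℝ≥0) : Set (ℝ≥0 × ℝ≥0) :=
  {q | S < q.1 ∧ q.1 < q.2 ∧ q.2 ≤ 1 ∧ (q.2 : ℝ) - q.1 ≤ S}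

/-- The increment `δA_{s,u,t} = A_{s,t} - A_{s,u} - A_{u,t}`. -/
def sewDelta {V : Type*} [AddCommGroup V] (A : ℝ≥0 → ℝ≥0 → V) (s u t : ℝ≥0) : V :=
  A s t - A s u - A u t

section

variable {Ω : Type*} {mΩ : MeasurableSpace Ω} {E : Type*} [NormedAddCommGroup E]
  [InnerProductSpace ℝ E] [FiniteDimensional ℝ E] {P : Measure Ω} {p : ℝ≥0∞}

/-- `‖𝐄^s X‖_{L_p(Ω)}` for `X ∈ L_p(Ω; E)`, where `𝐄^s` is the conditional expectation
with respect to `ℱ_s`. -/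
def condNorm (ℱ : Filtration ℝ≥0 mΩ) (s : ℝ≥0) (X : Lp E p P) : ℝ≥0∞ :=
  eLpNorm (P[(X : Ω → E) | ℱ s]) p P

/-- The two bounds
`‖𝒜_{s,t} - A_{s,t}‖_{L_p} ≤ K₁ |t - s|^{1/2 + ε₁} + K₂ |t - s|^{1 + ε₂}` and
`‖𝐄^s (𝒜_{s,t} - A_{s,t})‖_{L_p} ≤ K₂ |t - s|^{1 + ε₂}` on `[S, 1]^*_≤`. -/
def SewingBounds (ℱ : Filtration ℝ≥0 mΩ) (A : ℝ≥0 → ℝ≥0 → Lp E p P) (ε₁ ε₂ : ℝ)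
    (𝒜 : ℝ≥0 → Lp E p P) (S : ℝ≥0) (K₁ K₂ : ℝ) : Prop :=
  ∀ s t : ℝ≥0, (s, t) ∈ starPairs S →
    ‖𝒜 t - 𝒜 s - A s t‖ ≤
        K₁ * ((t : ℝ) - s) ^ (1 / 2 + ε₁) + K₂ * ((t : ℝ) - s) ^ (1 + ε₂) ∧
      condNorm ℱ s (𝒜 t - 𝒜 s - A s t) ≤
        ENNReal.ofReal (K₂ * ((t : ℝ) - s) ^ (1 + ε₂))

/-- `𝒜` (of which only the values on `[0, 1]` matter) is adapted, starts at `0`, is continuous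
at time `0` in `L_p`, and satisfies on every `[S, 1]^*_≤` the sewing bounds for `A` with some
constants which may depend on `S`. -/
structure IsSewing (ℱ : Filtration ℝ≥0 mΩ) (A : ℝ≥0 → ℝ≥0 → Lp E p P) (ε₁ ε₂ : ℝ)
    (𝒜 : ℝ≥0 → Lp E p P) : Prop where
  adapted : ∀ t : ℝ≥0, t ≤ 1 → AEStronglyMeasurable[ℱ t] (𝒜 t : Ω → E) P
  zero : 𝒜 0 = 0
  tendsto_zero : Tendsto (fun t : ℝ≥0 => ‖𝒜 t‖) (𝓝[>] 0) (𝓝 0)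
  bounds : ∀ S : ℝ≥0, 0 < S → S ≤ 1 →
    ∃ K₁ K₂ : ℝ, 0 ≤ K₁ ∧ 0 ≤ K₂ ∧ SewingBounds ℱ A ε₁ ε₂ 𝒜 S K₁ K₂

end

end

/-!
# The weighted stochastic sewing lemma

Everything rests on one estimate. Let `Z 0, Z 1, …` be increments adapted to a partition `x` and
let `d k` be the length of its `k`-th interval. Splitting `Z k` into its conditional expectation and
a martingale increment gives
`‖∑ Z k‖ ≤ ∑ ‖𝐄^{x k} Z k‖ + C (∑ ‖Z k‖²)^{1/2}` in `L_p`, `p ≥ 2` (`norm_sum_le_of_condLp`).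
No Burkholder inequality is needed: the square function bound follows by induction from
`‖X + Y‖² ≤ ‖X‖² + κ ‖Y‖²`, valid for `X` measurable and `Y` centred given a sub-σ-algebra
(`norm_add_sq_le_of_condLp_eq_zero`), which is a second order expansion of `‖·‖ ^ p` integrated.
If `‖Z k‖ ≲ (d k) ^ (1/2 + ε₁)` and `‖𝐄^{x k} Z k‖ ≲ (d k) ^ (1 + ε₂)`, then both sums are at most a
positive power of the mesh times the length of the whole interval or its square root
(`norm_sum_le_of_rpow`), since one factor of `d k` can be summed.

The sewn increment over `[s, t]` is the limit of the sums of `A` over the points of the dyadic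
grid `2⁻ⁿ ℕ` in `[s, t]`. The grid is the same for all intervals. Passing from level `n` to level
`n + 1` inserts at most one point into each interval, and so does the comparison of the sum over
`[s, t]` with the sums over `[s, u]` and `[u, t]`; both differences are sums of `δA` to which the
estimate applies (`SewingData.norm_sum_sewDelta_le`). The first gives convergence, the second
additivity of the limit. Starting at the level whose step is comparable with `t - s`, where at most
one grid point is inside `[s, t]`, the errors form geometric series, which yields the bounds of the
lemma (`SewingData.sewLimit_sub_le`).

For `s > 0` the hypotheses with any `S < s` apply to all sufficiently fine partitions of `[s, 1]`.
Near `0` the sewn increment over `[s, t]`, `t ≤ 2 s`, is of order `s ^ γ` with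
`γ = min (1/2 + ε₁ - δ₁) (1 + ε₂ - δ₂) > 0` (`norm_sewLimit_le_rpow`), so the process started at `1`
has a limit at `0`, and subtracting this limit gives `𝒜`. For uniqueness, the difference of two
sewings is adapted and satisfies the two increment bounds, so the estimate for its telescoping sums
shows that it is constant on `(0, 1]` (`eq_of_increment_bounds`); being continuous at `0`, it
vanishes.
-/

/-! ### A second order bound for powers of the norm -/

/-- The constant of the pointwise second order bound `norm_add_rpow_le`. -/
noncomputable def rpowTaylorConst (p : ℝ) : ℝ := 10 * p ^ 2 * 4 ^ p

lemma one_le_rpowTaylorConst {p : ℝ} (hp : 2 ≤ p) : 1 ≤ rpowTaylorConst p := by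
  have h4 : (1 : ℝ) ≤ 4 ^ p := Real.one_le_rpow (by norm_num) (by linarith)
  unfold rpowTaylorConst
  nlinarith [mul_le_mul (show (1 : ℝ) ≤ 10 * p ^ 2 by nlinarith) h4 (by norm_num) (by positivity)]

/-- Convexity of the power `q`, with the tangent taken at `1 + z` instead of `1`. -/
lemma one_add_rpow_le_one_add_mul_rpow {q z : ℝ} (hq : 1 ≤ q) (hz : -1 < z) :
    (1 + z) ^ q ≤ 1 + q * z * (1 + z) ^ (q - 1) := by
  have hpos : 0 < 1 + z := by linarith
  have hb := one_add_mul_self_le_rpow_one_add (s := -z / (1 + z))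
    (by rw [le_div_iff₀ hpos]; linarith) hq
  have he : 1 + -z / (1 + z) = (1 + z)⁻¹ := by field_simp; ring
  rw [he, Real.inv_rpow hpos.le] at hb
  have hpr : 0 < (1 + z) ^ q := Real.rpow_pos_of_pos hpos q
  have h2 := mul_le_mul_of_nonneg_left hb hpr.le
  rw [mul_inv_cancel₀ hpr.ne'] at h2
  rw [Real.rpow_sub_one hpos.ne']
  have h3 : (1 + z) ^ q * (1 + q * (-z / (1 + z))) =
    (1 + z) ^ q - q * z * ((1 + z) ^ q / (1 + z)) := by field_simp; ring
  linarith

/-- Second order expansion of `(1 + z) ^ q` with a bound on the remainder. -/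
lemma one_add_rpow_le_quadratic {q z : ℝ} (hq : 1 ≤ q) (hz : -1 ≤ z) (hz3 : z ≤ 3) :
    (1 + z) ^ q ≤ 1 + q * z + q ^ 2 * 4 ^ q * z ^ 2 := by
  have h4 : (1 : ℝ) ≤ 4 ^ q := Real.one_le_rpow (by norm_num) (by linarith)
  rcases eq_or_lt_of_le hz with rfl | hz1
  · norm_num
    rw [Real.zero_rpow (by linarith)]
    nlinarith
  have h0 : 0 ≤ 1 + z := by linarith
  have h1 := one_add_rpow_le_one_add_mul_rpow hq hz1
  rcases le_total 0 z with hz0 | hz0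
  · have hqz : 0 ≤ q * z := by positivity
    have h2 : (1 + z) ^ (q - 1) ≤ (1 + z) ^ q :=
      Real.rpow_le_rpow_of_exponent_le (by linarith) (by linarith)
    have h3 : (1 + z) ^ (q - 1) ≤ 4 ^ q :=
      h2.trans (Real.rpow_le_rpow h0 (by linarith) (by linarith))
    have h5 : (1 + z) ^ q ≤ 1 + q * z * 4 ^ q := by nlinarith
    nlinarith [mul_le_mul_of_nonneg_left (h2.trans h5) hqz]
  · have hqz : q * z ≤ 0 := mul_nonpos_of_nonneg_of_nonpos (by linarith) hz0
    have h2 : (1 + z) ^ q ≤ (1 + z) ^ (q - 1) :=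
      Real.rpow_le_rpow_of_exponent_ge (by linarith) (by linarith) (by linarith)
    have hb := one_add_mul_self_le_rpow_one_add hz hq
    have h5 := mul_le_mul_of_nonpos_left (hb.trans h2) hqz
    have : q ^ 2 * z ^ 2 ≤ q ^ 2 * 4 ^ q * z ^ 2 := by
      have : 0 ≤ q ^ 2 * z ^ 2 := by positivity
      nlinarith
    nlinarith

/-- `norm_add_rpow_le` for `‖x‖ = 1`, with `b = ‖y‖` and `c = ⟪x, y⟫`. -/
lemma one_add_two_mul_add_sq_rpow_le {p b c : ℝ} (hp : 2 ≤ p) (hb : 0 ≤ b) (hc : |c| ≤ b) :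
    (1 + 2 * c + b ^ 2) ^ (p / 2) ≤ 1 + p * c + rpowTaylorConst p * (b ^ 2 + b ^ p) := by
  have hq : 1 ≤ p / 2 := by linarith
  obtain ⟨hc1, hc2⟩ := abs_le.1 hc
  have h44 : (4 : ℝ) ^ (p / 2) ≤ 4 ^ p :=
    Real.rpow_le_rpow_of_exponent_le (by norm_num) (by linarith)
  have h41 : (1 : ℝ) ≤ 4 ^ p := Real.one_le_rpow (by norm_num) (by linarith)
  have hbp : 0 ≤ b ^ p := Real.rpow_nonneg hb p
  have hp2 : 4 ≤ p ^ 2 := by nlinarith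
  have hpp : p ^ 2 ≤ p ^ 2 * 4 ^ p := by nlinarith
  rcases le_total b 1 with h1 | h1
  · have h := one_add_rpow_le_quadratic (z := 2 * c + b ^ 2) hq (by nlinarith) (by nlinarith)
    have hz : (2 * c + b ^ 2) ^ 2 ≤ 9 * b ^ 2 := by
      have : |2 * c + b ^ 2| ≤ 3 * b := abs_le.2 ⟨by nlinarith, by nlinarith⟩
      calc (2 * c + b ^ 2) ^ 2 = |2 * c + b ^ 2| ^ 2 := (sq_abs _).symm
        _ ≤ (3 * b) ^ 2 := by gcongr
        _ = _ := by ring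
    have h2 : (p / 2) ^ 2 * 4 ^ (p / 2) * (2 * c + b ^ 2) ^ 2 ≤
        p ^ 2 / 4 * 4 ^ p * (9 * b ^ 2) := by
      have : (p / 2) ^ 2 = p ^ 2 / 4 := by ring
      rw [this]; gcongr
    have h3 : p * b ^ 2 ≤ p ^ 2 * 4 ^ p * b ^ 2 := by
      gcongr; nlinarith
    have h4 : 0 ≤ p ^ 2 * 4 ^ p * b ^ p := by positivity
    have h5 : 0 ≤ p ^ 2 * 4 ^ p * b ^ 2 := by positivity
    rw [← add_assoc] at h
    unfold rpowTaylorConst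
    nlinarith
  · have hbb : b ≤ b ^ p := by
      simpa using Real.rpow_le_rpow_of_exponent_le h1 (show (1 : ℝ) ≤ p by linarith)
    have h2 : (1 + 2 * c + b ^ 2) ^ (p / 2) ≤ (4 * b ^ 2) ^ (p / 2) :=
      Real.rpow_le_rpow (by nlinarith) (by nlinarith) (by linarith)
    have h3 : (4 * b ^ 2) ^ (p / 2) = 4 ^ (p / 2) * b ^ p := by
      rw [Real.mul_rpow (by norm_num) (by positivity), ← Real.rpow_natCast, ← Real.rpow_mul hb]
      congr 2; push_cast; ring
    have h4 : 4 ^ (p / 2) * b ^ p ≤ 4 ^ p * b ^ p := by gcongr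
    have h5 : 4 ^ p * b ^ p ≤ p ^ 2 * 4 ^ p * b ^ p := by
      gcongr; nlinarith
    have h6 : p * b ≤ p ^ 2 * 4 ^ p * b ^ p := by
      gcongr; nlinarith
    have h7 : 0 ≤ p ^ 2 * 4 ^ p * b ^ 2 := by positivity
    have h8 : 0 ≤ p ^ 2 * 4 ^ p * b ^ p := by positivity
    unfold rpowTaylorConst
    nlinarith

/-- Pointwise form of the 2-smoothness of `L_p`, `p ≥ 2`: a second order expansion of `‖·‖ ^ p`. -/
lemma norm_add_rpow_le {E : Type*} [NormedAddCommGroup E] [InnerProductSpace ℝ E] {p : ℝ}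
    (hp : 2 ≤ p) (x y : E) :
    ‖x + y‖ ^ p ≤ ‖x‖ ^ p + p * (‖x‖ ^ (p - 2) * inner ℝ x y) +
      rpowTaylorConst p * (‖x‖ ^ (p - 2) * ‖y‖ ^ 2 + ‖y‖ ^ p) := by
  have hC := one_le_rpowTaylorConst hp
  rcases eq_or_ne x 0 with rfl | hx
  · have h1 : 0 ≤ ‖y‖ ^ p := by positivity
    have h2 : 0 ≤ (0 : ℝ) ^ (p - 2) * ‖y‖ ^ 2 := by positivity
    simp only [zero_add, norm_zero, inner_zero_left, mul_zero, add_zero]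
    rw [Real.zero_rpow (by linarith)]
    nlinarith
  have ha : 0 < ‖x‖ := norm_pos_iff.2 hx
  have hc : |inner ℝ x y / ‖x‖ ^ 2| ≤ ‖y‖ / ‖x‖ := by
    rw [abs_div, abs_of_pos (by positivity : 0 < ‖x‖ ^ 2), div_le_div_iff₀ (by positivity) ha]
    nlinarith [abs_real_inner_le_norm x y]
  have h := one_add_two_mul_add_sq_rpow_le hp (by positivity) hc
  have hap : 0 < ‖x‖ ^ p := Real.rpow_pos_of_pos ha p
  have h' := mul_le_mul_of_nonneg_left h hap.le
  have e1 : ‖x‖ ^ p * (1 + 2 * (inner ℝ x y / ‖x‖ ^ 2) + (‖y‖ / ‖x‖) ^ 2) ^ (p / 2)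
      = ‖x + y‖ ^ p := by
    have : 1 + 2 * (inner ℝ x y / ‖x‖ ^ 2) + (‖y‖ / ‖x‖) ^ 2 = (‖x + y‖ / ‖x‖) ^ 2 := by
      rw [div_pow ‖x + y‖, norm_add_sq_real]; field_simp
    rw [this, ← Real.rpow_natCast, ← Real.rpow_mul (by positivity)]
    rw [show ((2 : ℕ) : ℝ) * (p / 2) = p by push_cast; ring,
      Real.div_rpow (norm_nonneg _) ha.le]
    field_simp
  have e2 : ‖x‖ ^ (p - 2) = ‖x‖ ^ p / ‖x‖ ^ 2 := by
    rw [Real.rpow_sub ha]; norm_num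
  have e3 : (‖y‖ / ‖x‖) ^ p = ‖y‖ ^ p / ‖x‖ ^ p := Real.div_rpow (norm_nonneg _) ha.le p
  rw [e1, e3] at h'
  rw [e2]
  refine h'.trans (le_of_eq ?_)
  field_simp

/-- The constant in the martingale inequality `norm_add_sq_le_of_condLp_eq_zero`. -/
noncomputable def martingaleConst (p : ℝ) : ℝ := 4 * rpowTaylorConst p

lemma one_le_martingaleConst {p : ℝ} (hp : 2 ≤ p) : 1 ≤ martingaleConst p := by
  have := one_le_rpowTaylorConst hp
  unfold martingaleConst; linarith

/-- The right-hand side is bounded below both by superadditivity of the power `p / 2` and by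
Bernoulli's inequality. The average of the two bounds absorbs both terms on the left, which fixes
`martingaleConst p` as four times `rpowTaylorConst p`. -/
lemma rpow_add_le_sq_add_sq_rpow {p a b : ℝ} (hp : 2 ≤ p) (ha : 0 < a) (hb : 0 ≤ b) :
    a ^ p + rpowTaylorConst p * (2 * (a ^ (p - 2) * b ^ 2) + b ^ p) ≤
      (a ^ 2 + martingaleConst p * b ^ 2) ^ (p / 2) := by
  have hC := one_le_rpowTaylorConst hp
  have hκ := one_le_martingaleConst hp
  have hq : 1 ≤ p / 2 := by linarith
  have hsq : ∀ c : ℝ, 0 ≤ c → (c ^ 2) ^ (p / 2) = c ^ p := by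
    intro c hc
    rw [← Real.rpow_natCast, ← Real.rpow_mul hc]; congr 1; push_cast; ring
  have h1 : a ^ p + martingaleConst p * b ^ p ≤ (a ^ 2 + martingaleConst p * b ^ 2) ^ (p / 2) := by
    refine le_trans ?_ (Real.add_rpow_le_rpow_add (by positivity) (by positivity) hq)
    rw [Real.mul_rpow (by positivity) (by positivity), hsq a ha.le, hsq b hb]
    gcongr
    simpa using Real.rpow_le_rpow_of_exponent_le hκ hq
  have h2 : a ^ p + martingaleConst p * (a ^ (p - 2) * b ^ 2) ≤
      (a ^ 2 + martingaleConst p * b ^ 2) ^ (p / 2) := by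
    have hb' := one_add_mul_self_le_rpow_one_add (s := martingaleConst p * b ^ 2 / a ^ 2)
      (le_trans (by norm_num) (by positivity : (0:ℝ) ≤ _)) hq
    have e1 : a ^ 2 + martingaleConst p * b ^ 2 =
      a ^ 2 * (1 + martingaleConst p * b ^ 2 / a ^ 2) := by field_simp
    have e2 : a ^ (p - 2) = a ^ p / a ^ 2 := by rw [Real.rpow_sub ha]; norm_num
    rw [e1, Real.mul_rpow (by positivity) (by positivity), hsq a ha.le, e2]
    have hap : 0 < a ^ p := Real.rpow_pos_of_pos ha p
    refine le_trans ?_ (mul_le_mul_of_nonneg_left hb' hap.le)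
    have : 0 ≤ martingaleConst p * b ^ 2 / a ^ 2 := by positivity
    have e3 : martingaleConst p * (a ^ p / a ^ 2 * b ^ 2) =
      a ^ p * (martingaleConst p * b ^ 2 / a ^ 2) := by field_simp
    rw [e3, mul_add, mul_one]
    gcongr
    nlinarith
  have h3 : 0 ≤ rpowTaylorConst p * b ^ p := by positivity
  unfold martingaleConst at *
  linarith

/-! ### Conditional expectation on `L_p` and the martingale inequality -/

section

variable {Ω : Type*} {mΩ : MeasurableSpace Ω} {E : Type*} [NormedAddCommGroup E]
  {P : Measure Ω}

lemma Lp.integrable_coe {q : ℝ≥0∞} [Fact (1 ≤ q)] [IsFiniteMeasure P] (X : Lp E q P) :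
    Integrable (X : Ω → E) P :=
  (Lp.memLp X).integrable Fact.out

/-- The classes in `L_q` with an `m`-measurable representative, as an additive subgroup. -/
def measurableLp (E : Type*) [NormedAddCommGroup E] (q : ℝ≥0∞) (P : Measure Ω)
    (m : MeasurableSpace Ω) : AddSubgroup (Lp E q P) where
  carrier := {X | AEStronglyMeasurable[m] (X : Ω → E) P}
  zero_mem' := (aestronglyMeasurable_const (b := (0 : E))).congr (Lp.coeFn_zero E q P).symm
  add_mem' := fun {X Y} hX hY => (AEStronglyMeasurable.add hX hY).congr (Lp.coeFn_add X Y).symm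
  neg_mem' := fun {X} hX => (AEStronglyMeasurable.neg hX).congr (Lp.coeFn_neg X).symm

lemma mem_measurableLp {q : ℝ≥0∞} {m : MeasurableSpace Ω} {X : Lp E q P} :
    X ∈ measurableLp E q P m ↔ AEStronglyMeasurable[m] (X : Ω → E) P := Iff.rfl

lemma measurableLp_mono {q : ℝ≥0∞} {m₁ m₂ : MeasurableSpace Ω} (h : m₁ ≤ m₂) :
    measurableLp E q P m₁ ≤ measurableLp E q P m₂ := fun _ hX => AEStronglyMeasurable.mono h hX

lemma isClosed_measurableLp [CompleteSpace E] {q : ℝ≥0∞} [Fact (1 ≤ q)]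
    {m : MeasurableSpace Ω} (hm : m ≤ mΩ) :
    IsClosed (measurableLp E q P m : Set (Lp E q P)) :=
  isClosed_aestronglyMeasurable hm

variable {p : ℝ}

lemma norm_rpow_eq_integral (hp : 0 < p) (X : Lp E (ENNReal.ofReal p) P) :
    ‖X‖ ^ p = ∫ ω, ‖X ω‖ ^ p ∂P := by
  have h := MemLp.eLpNorm_eq_integral_rpow_norm (by simpa using hp) ENNReal.ofReal_ne_top
    (Lp.memLp X)
  have h0 : 0 ≤ ∫ ω, ‖X ω‖ ^ p ∂P := integral_nonneg fun ω => by positivity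
  rw [ENNReal.toReal_ofReal hp.le] at h
  rw [Lp.norm_def, h, ENNReal.toReal_ofReal (by positivity), ← Real.rpow_mul h0,
    inv_mul_cancel₀ hp.ne', Real.rpow_one]

lemma integrable_norm_rpow_coe (hp : 0 < p) (X : Lp E (ENNReal.ofReal p) P) :
    Integrable (fun ω => ‖X ω‖ ^ p) P := by
  have := (Lp.memLp X).integrable_norm_rpow (by simpa using hp) ENNReal.ofReal_ne_top
  rwa [ENNReal.toReal_ofReal hp.le] at this

/-- A form of Young's inequality: compare `u` and `v` and bound the product by the larger power. -/
lemma rpow_sub_mul_rpow_le_add {u v r : ℝ} (hu : 0 ≤ u) (hv : 0 ≤ v) (hr : 0 ≤ r) (hrp : r ≤ p) :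
    u ^ (p - r) * v ^ r ≤ u ^ p + v ^ p := by
  have key : ∀ w : ℝ, 0 ≤ w → w ^ (p - r) * w ^ r = w ^ p := by
    intro w hw
    rw [← Real.rpow_add_of_nonneg hw (by linarith) hr]; congr 1; ring
  have h1 : 0 ≤ u ^ p := by positivity
  have h2 : 0 ≤ v ^ p := by positivity
  rcases le_total u v with h | h
  · have := mul_le_mul_of_nonneg_right (Real.rpow_le_rpow hu h (by linarith : 0 ≤ p - r))
      (by positivity : 0 ≤ v ^ r)
    rw [key v hv] at this; linarith
  · have := mul_le_mul_of_nonneg_left (Real.rpow_le_rpow hv h hr)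
      (by positivity : 0 ≤ u ^ (p - r))
    rw [key u hu] at this; linarith

lemma integrable_rpow_mul_sq (hp : 2 ≤ p) (X Y : Lp E (ENNReal.ofReal p) P) :
    Integrable (fun ω => ‖X ω‖ ^ (p - 2) * ‖Y ω‖ ^ 2) P := by
  have hX := Lp.aestronglyMeasurable X
  have hY := Lp.aestronglyMeasurable Y
  refine ((integrable_norm_rpow_coe (by linarith) X).add
    (integrable_norm_rpow_coe (by linarith) Y)).mono' ?_ (ae_of_all _ fun ω => ?_)
  · exact ((Real.continuous_rpow_const (by linarith)).comp_aestronglyMeasurable hX.norm).mul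
      (hY.norm.pow 2)
  · rw [Real.norm_of_nonneg (by positivity)]
    have := rpow_sub_mul_rpow_le_add (r := 2) (p := p) (norm_nonneg (X ω)) (norm_nonneg (Y ω))
      (by norm_num) hp
    simpa using this

lemma integral_rpow_mul_sq_le (hp : 2 ≤ p) (X Y : Lp E (ENNReal.ofReal p) P) (hX0 : 0 < ‖X‖)
    (hY0 : 0 < ‖Y‖) :
    ∫ ω, ‖X ω‖ ^ (p - 2) * ‖Y ω‖ ^ 2 ∂P ≤ 2 * (‖X‖ ^ (p - 2) * ‖Y‖ ^ 2) := by
  have hp0 : 0 < p := by linarith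
  have hXi := integrable_norm_rpow_coe hp0 X
  have hYi := integrable_norm_rpow_coe hp0 Y
  -- Young's inequality for the normalised functions.
  have h : ∀ ω, ‖X ω‖ ^ (p - 2) * ‖Y ω‖ ^ 2 ≤ (‖X‖ ^ (p - 2) * ‖Y‖ ^ 2) *
      (‖X ω‖ ^ p / ‖X‖ ^ p + ‖Y ω‖ ^ p / ‖Y‖ ^ p) := by
    intro ω
    have := rpow_sub_mul_rpow_le_add (r := 2) (p := p) (u := ‖X ω‖ / ‖X‖) (v := ‖Y ω‖ / ‖Y‖)
      (by positivity) (by positivity) (by norm_num) hp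
    rw [Real.div_rpow (by positivity) (by positivity),
      Real.div_rpow (by positivity) (by positivity),
      Real.div_rpow (by positivity) (by positivity),
      Real.div_rpow (by positivity) (by positivity), Real.rpow_two, Real.rpow_two] at this
    have h2 := mul_le_mul_of_nonneg_left this
      (by positivity : 0 ≤ ‖X‖ ^ (p - 2) * ‖Y‖ ^ 2)
    refine le_trans (le_of_eq ?_) h2
    have : 0 < ‖X‖ ^ (p - 2) := Real.rpow_pos_of_pos hX0 _
    field_simp
  have hsum : Integrable (fun ω => ‖X ω‖ ^ p / ‖X‖ ^ p + ‖Y ω‖ ^ p / ‖Y‖ ^ p) P :=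
    (hXi.div_const _).add (hYi.div_const _)
  refine (integral_mono (integrable_rpow_mul_sq hp X Y) (hsum.const_mul _) h).trans (le_of_eq ?_)
  rw [integral_const_mul, integral_add (hXi.div_const _) (hYi.div_const _), integral_div,
    integral_div, ← norm_rpow_eq_integral hp0, ← norm_rpow_eq_integral hp0, div_self, div_self]
  · ring
  · exact (Real.rpow_pos_of_pos hY0 _).ne'
  · exact (Real.rpow_pos_of_pos hX0 _).ne'

lemma integrable_rpow_mul_inner [InnerProductSpace ℝ E] (hp : 2 ≤ p)
    (X Y : Lp E (ENNReal.ofReal p) P) :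
    Integrable (fun ω => inner ℝ (‖X ω‖ ^ (p - 2) • X ω) (Y ω)) P := by
  have hX := Lp.aestronglyMeasurable X
  have hY := Lp.aestronglyMeasurable Y
  refine ((integrable_norm_rpow_coe (by linarith) X).add
    (integrable_norm_rpow_coe (by linarith) Y)).mono' ?_ (ae_of_all _ fun ω => ?_)
  · have hr : AEStronglyMeasurable (fun ω => ‖X ω‖ ^ (p - 2)) P :=
      (Real.continuous_rpow_const (by linarith)).comp_aestronglyMeasurable hX.norm
    exact (hr.smul hX).inner hY
  · refine (norm_inner_le_norm _ _).trans ?_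
    rw [norm_smul, Real.norm_of_nonneg (by positivity)]
    have := rpow_sub_mul_rpow_le_add (r := 1) (p := p) (norm_nonneg (X ω)) (norm_nonneg (Y ω))
      (by norm_num) (by linarith)
    refine le_trans (le_of_eq ?_) this
    rw [Real.rpow_one]
    nth_rewrite 2 [← Real.rpow_one ‖X ω‖]
    rw [← Real.rpow_add_of_nonneg (norm_nonneg _) (by linarith) (by norm_num)]
    congr 2; ring

end

section

variable {Ω : Type*} {mΩ : MeasurableSpace Ω} {E : Type*} [NormedAddCommGroup E]
  [InnerProductSpace ℝ E] [FiniteDimensional ℝ E] {P : Measure Ω} [IsProbabilityMeasure P]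

section CondLp

variable {q : ℝ≥0∞} [Fact (1 ≤ q)]

/-- Conditional expectation given `m` as an additive map `L_q → L_q`. -/
noncomputable def condLp (m : MeasurableSpace Ω) : Lp E q P →+ Lp E q P :=
  AddMonoidHom.mk' (fun X =>
    MemLp.toLp (P[(X : Ω → E) | m]) (MemLp.condExp Fact.out (Lp.memLp X))) (by
    intro X Y
    rw [← MemLp.toLp_add]
    refine MemLp.toLp_congr _ _ ?_
    exact (condExp_congr_ae (Lp.coeFn_add X Y)).trans
      (condExp_add (Lp.integrable_coe X) (Lp.integrable_coe Y) m))

lemma coeFn_condLp (m : MeasurableSpace Ω) (X : Lp E q P) :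
    (condLp m X : Ω → E) =ᵐ[P] P[(X : Ω → E) | m] :=
  MemLp.coeFn_toLp (MemLp.condExp Fact.out (Lp.memLp X))

lemma norm_condLp_le (m : MeasurableSpace Ω) (X : Lp E q P) : ‖condLp m X‖ ≤ ‖X‖ := by
  rw [Lp.norm_def, Lp.norm_def, eLpNorm_congr_ae (coeFn_condLp m X)]
  exact ENNReal.toReal_mono (Lp.eLpNorm_ne_top X) (eLpNorm_condExp_le_eLpNorm _ Fact.out)

lemma condNorm_eq (ℱ : Filtration ℝ≥0 mΩ) (s : ℝ≥0) (X : Lp E q P) :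
    condNorm ℱ s X = ENNReal.ofReal ‖condLp (ℱ s) X‖ := by
  rw [condNorm, Lp.norm_def, ENNReal.ofReal_toReal (Lp.eLpNorm_ne_top _),
    eLpNorm_congr_ae (coeFn_condLp (ℱ s) X)]

lemma condNorm_le_ofReal_iff (ℱ : Filtration ℝ≥0 mΩ) (s : ℝ≥0) (X : Lp E q P) {b : ℝ}
    (hb : 0 ≤ b) : condNorm ℱ s X ≤ ENNReal.ofReal b ↔ ‖condLp (ℱ s) X‖ ≤ b := by
  rw [condNorm_eq, ENNReal.ofReal_le_ofReal_iff hb]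

lemma condLp_condLp_of_le {m₁ m₂ : MeasurableSpace Ω} (h₁₂ : m₁ ≤ m₂) (h₂ : m₂ ≤ mΩ)
    (X : Lp E q P) : condLp m₁ (condLp m₂ X) = condLp m₁ X := by
  refine Lp.ext ?_
  refine (coeFn_condLp m₁ _).trans ?_
  refine (condExp_congr_ae (coeFn_condLp m₂ X)).trans ?_
  exact (condExp_condExp_of_le h₁₂ h₂).trans (coeFn_condLp m₁ X).symm

lemma norm_condLp_le_norm_condLp {m₁ m₂ : MeasurableSpace Ω} (h₁₂ : m₁ ≤ m₂) (h₂ : m₂ ≤ mΩ)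
    (X : Lp E q P) : ‖condLp m₁ X‖ ≤ ‖condLp m₂ X‖ := by
  rw [← condLp_condLp_of_le h₁₂ h₂ X]
  exact norm_condLp_le _ _

lemma aestronglyMeasurable_condLp (m : MeasurableSpace Ω) (X : Lp E q P) :
    AEStronglyMeasurable[m] (condLp m X : Ω → E) P :=
  stronglyMeasurable_condExp.aestronglyMeasurable.congr (coeFn_condLp m X).symm

end CondLp

variable {p : ℝ}

variable [Fact (1 ≤ ENNReal.ofReal p)]

/-- The derivative term in the expansion of `‖X + Y‖ ^ p` integrates to zero when `X` is
`m`-measurable and `Y` has vanishing conditional expectation given `m`. -/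
lemma integral_rpow_mul_inner_eq_zero (hp : 2 ≤ p) {m : MeasurableSpace Ω} (hm : m ≤ mΩ)
    {X Y : Lp E (ENNReal.ofReal p) P} (hX : X ∈ measurableLp E (ENNReal.ofReal p) P m)
    (hY : condLp m Y = 0) :
    ∫ ω, inner ℝ (‖X ω‖ ^ (p - 2) • X ω) (Y ω) ∂P = 0 := by
  rw [mem_measurableLp] at hX
  have hf : AEStronglyMeasurable[m] (fun ω => ‖X ω‖ ^ (p - 2) • X ω) P := by
    obtain ⟨g, hg, hXg⟩ := hX
    have hc : Continuous fun x : E => ‖x‖ ^ (p - 2) • x :=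
      (continuous_norm.rpow_const fun _ => Or.inr (by linarith)).smul continuous_id
    exact ⟨fun ω => ‖g ω‖ ^ (p - 2) • g ω, hc.comp_stronglyMeasurable hg,
      hXg.mono fun ω h => by simp only [h]⟩
  have h := condExp_bilin_of_aestronglyMeasurable_left (innerSL ℝ) hf
    (integrable_rpow_mul_inner hp X Y) (Lp.integrable_coe Y)
  have hY' : P[(Y : Ω → E) | m] =ᵐ[P] 0 := by
    refine (coeFn_condLp m Y).symm.trans ?_
    rw [hY]; exact Lp.coeFn_zero _ _ _
  have h0 : P[fun ω => innerSL ℝ (‖X ω‖ ^ (p - 2) • X ω) (Y ω) | m] =ᵐ[P] 0 := by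
    filter_upwards [h, hY'] with ω h1 h2
    rw [h1, h2]; simp
  have := integral_condExp (μ := P) hm (f := fun ω => innerSL ℝ (‖X ω‖ ^ (p - 2) • X ω) (Y ω))
  rw [integral_congr_ae h0] at this
  simpa [real_inner_smul_left] using this.symm

/-- Adding a martingale increment: the two-term case of the `L_p` martingale inequality, `p ≥ 2`. -/
lemma norm_add_sq_le_of_condLp_eq_zero (hp : 2 ≤ p) {m : MeasurableSpace Ω} (hm : m ≤ mΩ)
    {X Y : Lp E (ENNReal.ofReal p) P} (hX : X ∈ measurableLp E (ENNReal.ofReal p) P m)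
    (hY : condLp m Y = 0) :
    ‖X + Y‖ ^ 2 ≤ ‖X‖ ^ 2 + martingaleConst p * ‖Y‖ ^ 2 := by
  have hp0 : 0 < p := by linarith
  have hκ := one_le_martingaleConst hp
  have hC := one_le_rpowTaylorConst hp
  rcases eq_or_ne X 0 with rfl | hX0
  · simp only [zero_add, norm_zero]
    nlinarith [sq_nonneg ‖Y‖]
  rcases eq_or_ne Y 0 with rfl | hY0
  · simp
  rw [← norm_pos_iff] at hX0 hY0
  have hint : ‖X + Y‖ ^ p ≤ ‖X‖ ^ p +
      rpowTaylorConst p * (2 * (‖X‖ ^ (p - 2) * ‖Y‖ ^ 2) + ‖Y‖ ^ p) := by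
    have hXi := integrable_norm_rpow_coe hp0 X
    have hYi := integrable_norm_rpow_coe hp0 Y
    have hXY := integrable_rpow_mul_sq hp X Y
    have hin := integrable_rpow_mul_inner hp X Y
    have hlin : Integrable
        (fun ω => ‖X ω‖ ^ p + p * inner ℝ (‖X ω‖ ^ (p - 2) • X ω) (Y ω)) P :=
      hXi.add (hin.const_mul p)
    have hquad : Integrable (fun ω => ‖X ω‖ ^ (p - 2) * ‖Y ω‖ ^ 2 + ‖Y ω‖ ^ p) P := hXY.add hYi
    have h1 : ∫ ω, ‖(X + Y : Lp E (ENNReal.ofReal p) P) ω‖ ^ p ∂P ≤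
        ∫ ω, (‖X ω‖ ^ p + p * inner ℝ (‖X ω‖ ^ (p - 2) • X ω) (Y ω) +
          rpowTaylorConst p * (‖X ω‖ ^ (p - 2) * ‖Y ω‖ ^ 2 + ‖Y ω‖ ^ p)) ∂P := by
      refine integral_mono_ae (integrable_norm_rpow_coe hp0 _)
        (hlin.add (hquad.const_mul _)) ?_
      filter_upwards [Lp.coeFn_add X Y] with ω hω
      rw [hω, real_inner_smul_left]
      exact norm_add_rpow_le hp _ _
    rw [integral_add hlin (hquad.const_mul _), integral_add hXi (hin.const_mul p),
      integral_const_mul, integral_const_mul,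
      integral_rpow_mul_inner_eq_zero hp hm hX hY, integral_add hXY hYi,
      ← norm_rpow_eq_integral hp0, ← norm_rpow_eq_integral hp0, ← norm_rpow_eq_integral hp0] at h1
    have h2 := integral_rpow_mul_sq_le hp X Y hX0 hY0
    have h3 := mul_le_mul_of_nonneg_left h2 (by linarith : 0 ≤ rpowTaylorConst p)
    linarith
  have h := hint.trans (rpow_add_le_sq_add_sq_rpow hp hX0 hY0.le)
  have e : ‖X + Y‖ ^ p = (‖X + Y‖ ^ 2) ^ (p / 2) := by
    rw [← Real.rpow_natCast, ← Real.rpow_mul (norm_nonneg _)]; congr 1; push_cast; ring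
  rw [e] at h
  exact (Real.rpow_le_rpow_iff (by positivity) (by positivity) (by linarith)).1 h

/-- The `L_p` martingale inequality, `p ≥ 2`: `‖∑ Y k‖² ≤ κ ∑ ‖Y k‖²` for martingale increments. -/
lemma norm_sum_sq_le_of_condLp_eq_zero (hp : 2 ≤ p) (ℱ : Filtration ℝ≥0 mΩ) {x : ℕ → ℝ≥0}
    (hx : Monotone x) {Y : ℕ → Lp E (ENNReal.ofReal p) P}
    (hYm : ∀ k, Y k ∈ measurableLp E (ENNReal.ofReal p) P (ℱ (x (k + 1))))
    (hY0 : ∀ k, condLp (ℱ (x k)) (Y k) = 0) (n : ℕ) :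
    ‖∑ k ∈ Finset.range n, Y k‖ ^ 2 ≤
      martingaleConst p * ∑ k ∈ Finset.range n, ‖Y k‖ ^ 2 := by
  have hκ := one_le_martingaleConst hp
  induction n with
  | zero => simp
  | succ n ih =>
    rw [Finset.sum_range_succ, Finset.sum_range_succ, mul_add]
    refine (norm_add_sq_le_of_condLp_eq_zero hp (ℱ.le (x n)) ?_ (hY0 n)).trans (by linarith)
    refine AddSubgroup.sum_mem _ fun k hk => ?_
    refine measurableLp_mono (ℱ.mono (hx ?_)) (hYm k)
    exact Finset.mem_range.1 hk

/-- The estimate behind stochastic sewing: a sum of adapted increments is bounded by the sum of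
the norms of their conditional expectations plus a square function of their norms. -/
lemma norm_sum_le_of_condLp (hp : 2 ≤ p) (ℱ : Filtration ℝ≥0 mΩ) {x : ℕ → ℝ≥0}
    (hx : Monotone x) {Z : ℕ → Lp E (ENNReal.ofReal p) P} {a b : ℕ → ℝ}
    (hZm : ∀ k, Z k ∈ measurableLp E (ENNReal.ofReal p) P (ℱ (x (k + 1))))
    (ha : ∀ k, ‖Z k‖ ≤ a k) (hb : ∀ k, ‖condLp (ℱ (x k)) (Z k)‖ ≤ b k) (n : ℕ) :
    ‖∑ k ∈ Finset.range n, Z k‖ ≤ ∑ k ∈ Finset.range n, b k +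
      2 * martingaleConst p * √(∑ k ∈ Finset.range n, a k ^ 2) := by
  have hκ := one_le_martingaleConst hp
  set Y : ℕ → Lp E (ENNReal.ofReal p) P := fun k => Z k - condLp (ℱ (x k)) (Z k) with hY
  have h1 : ∑ k ∈ Finset.range n, Z k =
      ∑ k ∈ Finset.range n, condLp (ℱ (x k)) (Z k) + ∑ k ∈ Finset.range n, Y k := by
    rw [← Finset.sum_add_distrib]; simp [hY]
  have hYa : ∀ k, ‖Y k‖ ≤ 2 * a k := fun k => by
    have := norm_sub_le (Z k) (condLp (ℱ (x k)) (Z k))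
    have := norm_condLp_le (ℱ (x k)) (Z k)
    have := ha k
    simp only [hY]; linarith
  have h2 := norm_sum_sq_le_of_condLp_eq_zero hp ℱ hx (Y := Y)
    (fun k => AddSubgroup.sub_mem _ (hZm k)
      (measurableLp_mono (ℱ.mono (hx k.le_succ)) (aestronglyMeasurable_condLp _ _)))
    (fun k => by simp only [hY, map_sub]; rw [condLp_condLp_of_le le_rfl (ℱ.le _), sub_self]) n
  have h3 : ∑ k ∈ Finset.range n, ‖Y k‖ ^ 2 ≤ 4 * ∑ k ∈ Finset.range n, a k ^ 2 := by
    rw [Finset.mul_sum]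
    refine Finset.sum_le_sum fun k _ => ?_
    have := pow_le_pow_left₀ (norm_nonneg _) (hYa k) 2
    linarith
  have hs : 0 ≤ ∑ k ∈ Finset.range n, a k ^ 2 := Finset.sum_nonneg fun k _ => sq_nonneg _
  have h4 : ‖∑ k ∈ Finset.range n, Y k‖ ≤
      2 * martingaleConst p * √(∑ k ∈ Finset.range n, a k ^ 2) := by
    refine abs_le_of_sq_le_sq' ?_ (by positivity) |>.2
    rw [mul_pow, Real.sq_sqrt hs]
    nlinarith
  rw [h1]
  refine (norm_add_le _ _).trans (add_le_add ?_ h4)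
  exact (norm_sum_le _ _).trans (Finset.sum_le_sum fun k _ => hb k)

end

/-! ### Sums over dyadic grids -/

section

variable {V : Type*} [AddCommGroup V]

/-- The two-parameter map `A` set to `0` off the region `s < t`, so that degenerate intervals of a
partition contribute nothing. -/
noncomputable def strictPart (A : ℝ≥0 → ℝ≥0 → V) (s t : ℝ≥0) : V := if s < t then A s t else 0

@[simp] lemma strictPart_self (A : ℝ≥0 → ℝ≥0 → V) (s : ℝ≥0) : strictPart A s s = 0 := by
  simp [strictPart]

lemma strictPart_of_lt (A : ℝ≥0 → ℝ≥0 → V) {s t : ℝ≥0} (h : s < t) : strictPart A s t = A s t := by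
  simp [strictPart, h]

lemma sewDelta_strictPart_left (A : ℝ≥0 → ℝ≥0 → V) (s t : ℝ≥0) :
    sewDelta (strictPart A) s s t = 0 := by simp [sewDelta]

lemma sewDelta_strictPart_right (A : ℝ≥0 → ℝ≥0 → V) (s t : ℝ≥0) :
    sewDelta (strictPart A) s t t = 0 := by simp [sewDelta]

lemma sewDelta_strictPart (A : ℝ≥0 → ℝ≥0 → V) {s u t : ℝ≥0} (hsu : s < u) (hut : u < t) :
    sewDelta (strictPart A) s u t = sewDelta A s u t := by
  simp [sewDelta, strictPart, hsu, hut, hsu.trans hut]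

/-- The dyadic point `k / 2 ^ n` projected onto the interval `[s, t]`. -/
noncomputable def clampGrid (s t : ℝ≥0) (n k : ℕ) : ℝ≥0 := max s (min t (k / 2 ^ n))

lemma clampGrid_mono (s t : ℝ≥0) (n : ℕ) : Monotone (clampGrid s t n) := by
  intro k l h
  unfold clampGrid
  gcongr

lemma le_clampGrid (s t : ℝ≥0) (n k : ℕ) : s ≤ clampGrid s t n k := le_max_left _ _

lemma clampGrid_le {s t : ℝ≥0} (h : s ≤ t) (n k : ℕ) : clampGrid s t n k ≤ t :=
  max_le h (min_le_left _ _)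

@[simp] lemma clampGrid_zero (s t : ℝ≥0) (n : ℕ) : clampGrid s t n 0 = s := by
  simp [clampGrid]

lemma clampGrid_two_pow {s t : ℝ≥0} (h : s ≤ t) (ht : t ≤ 1) (n : ℕ) :
    clampGrid s t n (2 ^ n) = t := by
  simp [clampGrid, ht, h]

lemma clampGrid_succ_two_mul (s t : ℝ≥0) (n k : ℕ) :
    clampGrid s t (n + 1) (2 * k) = clampGrid s t n k := by
  unfold clampGrid
  congr 2
  push_cast
  rw [pow_succ]
  field_simp

lemma clampGrid_succ_sub_le (s t : ℝ≥0) (n k : ℕ) :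
    (clampGrid s t n (k + 1) : ℝ) - clampGrid s t n k ≤ (2 ^ n)⁻¹ := by
  unfold clampGrid
  have hp : (0 : ℝ) < (2 ^ n)⁻¹ := by positivity
  have h : ((k + 1 : ℕ) : ℝ) / 2 ^ n = k / 2 ^ n + (2 ^ n)⁻¹ := by
    push_cast; field_simp
  push_cast at h ⊢
  rw [h]
  generalize (k : ℝ) / 2 ^ n = g
  generalize ((2 : ℝ) ^ n)⁻¹ = d at hp ⊢
  rcases max_cases (s : ℝ) (min t (g + d)) with ⟨h1, h2⟩ | ⟨h1, h2⟩ <;>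
  rcases max_cases (s : ℝ) (min t g) with ⟨h3, h4⟩ | ⟨h3, h4⟩ <;>
  rcases min_cases (t : ℝ) (g + d) with ⟨h5, h6⟩ | ⟨h5, h6⟩ <;>
  rcases min_cases (t : ℝ) g with ⟨h7, h8⟩ | ⟨h7, h8⟩ <;> linarith

lemma clampGrid_left {s u t : ℝ≥0} (hsu : s ≤ u) (hut : u ≤ t) (n k : ℕ) :
    clampGrid s u n k = min u (clampGrid s t n k) := by
  unfold clampGrid
  rw [min_max_distrib_left, min_eq_right hsu, ← min_assoc, min_eq_left hut]

lemma clampGrid_right {s u t : ℝ≥0} (hsu : s ≤ u) (n k : ℕ) :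
    clampGrid u t n k = max u (clampGrid s t n k) := by
  unfold clampGrid
  rw [← max_assoc, max_eq_left hsu]

/-- The sum of `A` over the partition of `[s, t]` by the dyadic points of level `n`. The grid does
not depend on `[s, t]`, which makes the limit in `n` additive in the interval. -/
noncomputable def gridSum (A : ℝ≥0 → ℝ≥0 → V) (n : ℕ) (s t : ℝ≥0) : V :=
  ∑ k ∈ Finset.range (2 ^ n), strictPart A (clampGrid s t n k) (clampGrid s t n (k + 1))

lemma sum_range_two_mul (f : ℕ → V) (m : ℕ) :
    ∑ i ∈ Finset.range (2 * m), f i = ∑ k ∈ Finset.range m, (f (2 * k) + f (2 * k + 1)) := by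
  induction m with
  | zero => simp
  | succ m ih =>
    rw [Finset.sum_range_succ, ← ih, show 2 * (m + 1) = 2 * m + 1 + 1 by ring,
      Finset.sum_range_succ, Finset.sum_range_succ, add_assoc]

lemma gridSum_sub_gridSum_succ (A : ℝ≥0 → ℝ≥0 → V) (n : ℕ) (s t : ℝ≥0) :
    gridSum A n s t - gridSum A (n + 1) s t =
      ∑ k ∈ Finset.range (2 ^ n), sewDelta (strictPart A) (clampGrid s t n k)
        (clampGrid s t (n + 1) (2 * k + 1)) (clampGrid s t n (k + 1)) := by
  unfold gridSum
  rw [pow_succ' 2 n, sum_range_two_mul, ← Finset.sum_sub_distrib]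
  refine Finset.sum_congr rfl fun k _ => ?_
  rw [clampGrid_succ_two_mul, show 2 * k + 1 + 1 = 2 * (k + 1) by ring, clampGrid_succ_two_mul]
  simp only [sewDelta]
  abel

lemma strictPart_sub_split (A : ℝ≥0 → ℝ≥0 → V) (u : ℝ≥0) {x y : ℝ≥0} (h : x ≤ y) :
    strictPart A x y - strictPart A (min u x) (min u y) - strictPart A (max u x) (max u y) =
      sewDelta (strictPart A) x (max x (min u y)) y := by
  rcases le_total u x with h1 | h1
  · simp [sewDelta, min_eq_left h1, min_eq_left (h1.trans h), max_eq_right h1,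
      max_eq_right (h1.trans h), max_eq_left h1]
  rcases le_total u y with h2 | h2
  · simp [sewDelta, min_eq_left h2, min_eq_right h1, max_eq_left h1, max_eq_right h2,
      max_eq_right h1]
  · simp [sewDelta, min_eq_right h2, min_eq_right h1, max_eq_left h1, max_eq_left h2,
      max_eq_right h]

lemma gridSum_sub_split (A : ℝ≥0 → ℝ≥0 → V) (n : ℕ) {s u t : ℝ≥0} (hsu : s ≤ u) (hut : u ≤ t) :
    gridSum A n s t - gridSum A n s u - gridSum A n u t =
      ∑ k ∈ Finset.range (2 ^ n), sewDelta (strictPart A) (clampGrid s t n k)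
        (max (clampGrid s t n k) (min u (clampGrid s t n (k + 1)))) (clampGrid s t n (k + 1)) := by
  unfold gridSum
  rw [← Finset.sum_sub_distrib, ← Finset.sum_sub_distrib]
  refine Finset.sum_congr rfl fun k _ => ?_
  rw [← strictPart_sub_split A u (clampGrid_mono s t n k.le_succ)]
  simp only [clampGrid_left hsu hut, clampGrid_right (t := t) hsu]

/-- On an interval no longer than the grid step, at most one grid point lies inside. -/
lemma exists_strictPart_sub_gridSum_eq (A : ℝ≥0 → ℝ≥0 → V) (n : ℕ) {s t : ℝ≥0} (hst : s ≤ t)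
    (ht : t ≤ 1) (h : (t : ℝ) - s ≤ (2 ^ n)⁻¹) :
    ∃ u, s ≤ u ∧ u ≤ t ∧ strictPart A s t - gridSum A n s t = sewDelta (strictPart A) s u t := by
  set x := clampGrid s t n with hx
  suffices H : ∃ u, s ≤ u ∧ u ≤ t ∧ gridSum A n s t = strictPart A s u + strictPart A u t by
    obtain ⟨u, h1, h2, h3⟩ := H
    exact ⟨u, h1, h2, by rw [h3, sewDelta]; abel⟩
  have hstep : ∀ k, s < x k → x (k + 1) = t := by
    intro k hk
    have h1 : s < (k : ℝ≥0) / 2 ^ n := by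
      rcases lt_max_iff.1 hk with h0 | h0
      · exact absurd h0 (lt_irrefl _)
      · exact (lt_min_iff.1 h0).2
    have h2 : t ≤ ((k + 1 : ℕ) : ℝ≥0) / 2 ^ n := by
      rw [← NNReal.coe_lt_coe] at h1
      rw [← NNReal.coe_le_coe]
      push_cast at h1 ⊢
      have : ((k : ℝ) + 1) / 2 ^ n = k / 2 ^ n + (2 ^ n)⁻¹ := by field_simp
      linarith
    rw [hx, clampGrid, min_eq_left h2, max_eq_right hst]
  have key : ∀ m, (x m = s ∧
        ∑ k ∈ Finset.range m, strictPart A (x k) (x (k + 1)) = 0) ∨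
      (s < x m ∧ ∑ k ∈ Finset.range m, strictPart A (x k) (x (k + 1)) = strictPart A s (x m)) ∨
      (x m = t ∧ ∃ u, s ≤ u ∧ u ≤ t ∧ ∑ k ∈ Finset.range m, strictPart A (x k) (x (k + 1)) =
        strictPart A s u + strictPart A u t) := by
    intro m
    induction m with
    | zero => left; simp [hx]
    | succ m ih =>
      rw [Finset.sum_range_succ]
      rcases ih with ⟨h1, h2⟩ | ⟨h1, h2⟩ | ⟨h1, u, h2, h3, h4⟩
      · rcases (le_clampGrid s t n (m + 1)).eq_or_lt with h3 | h3
        · left; rw [h1, h2, hx, ← h3]; simp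
        · right; left; exact ⟨h3, by rw [h1, h2, zero_add]⟩
      · right; right
        exact ⟨hstep m h1, x m, h1.le, clampGrid_le hst n m, by rw [h2, hstep m h1]⟩
      · right; right
        have h5 : x (m + 1) = t :=
          le_antisymm (clampGrid_le hst n _) (h1 ▸ clampGrid_mono s t n m.le_succ)
        exact ⟨h5, u, h2, h3, by rw [h4, h1, h5]; simp⟩
  have hN : x (2 ^ n) = t := clampGrid_two_pow hst ht n
  rcases key (2 ^ n) with ⟨h1, h2⟩ | ⟨h1, h2⟩ | ⟨_, h2⟩
  · refine ⟨s, le_rfl, hst, h2.trans ?_⟩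
    rw [← hN, h1]; simp
  · exact ⟨t, hst, le_rfl, h2.trans (by rw [hN]; simp)⟩
  · exact h2

end

/-- Powers above `1` of the lengths of a partition: one factor is summed, the rest is bounded by the
mesh `μ`. -/
lemma sum_rpow_one_add_le {x : ℕ → ℝ≥0} (hx : Monotone x) {μ e : ℝ} (he : 0 ≤ e)
    (hμ : ∀ k, (x (k + 1) : ℝ) - x k ≤ μ) (n : ℕ) :
    ∑ k ∈ Finset.range n, ((x (k + 1) : ℝ) - x k) ^ (1 + e) ≤ μ ^ e * ((x n : ℝ) - x 0) := by
  rw [← Finset.sum_range_sub (fun k => (x k : ℝ)), Finset.mul_sum]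
  refine Finset.sum_le_sum fun k _ => ?_
  have h0 : 0 ≤ (x (k + 1) : ℝ) - x k := sub_nonneg.2 (NNReal.coe_le_coe.2 (hx k.le_succ))
  rw [Real.rpow_add_of_nonneg h0 zero_le_one he, Real.rpow_one, mul_comm]
  exact mul_le_mul_of_nonneg_right (Real.rpow_le_rpow h0 (hμ k) he) h0

section

variable {Ω : Type*} {mΩ : MeasurableSpace Ω} {E : Type*} [NormedAddCommGroup E]
  [InnerProductSpace ℝ E] [FiniteDimensional ℝ E] {P : Measure Ω} [IsProbabilityMeasure P]
  {p : ℝ} [Fact (1 ≤ ENNReal.ofReal p)]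

/-- `norm_sum_le_of_condLp` for increments whose norms have order `1/2 + ε₁` and whose conditional
expectations have order `1 + ε₂` in the length of the interval. No bound on the number of intervals
enters. -/
lemma norm_sum_le_of_rpow (hp : 2 ≤ p) (ℱ : Filtration ℝ≥0 mΩ) {x : ℕ → ℝ≥0} (hx : Monotone x)
    {Z : ℕ → Lp E (ENNReal.ofReal p) P} {a b ε₁ ε₂ μ : ℝ} (hε₁ : 0 ≤ ε₁) (hε₂ : 0 ≤ ε₂)
    (ha : 0 ≤ a) (hb : 0 ≤ b) (hμ : ∀ k, (x (k + 1) : ℝ) - x k ≤ μ)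
    (hZm : ∀ k, Z k ∈ measurableLp E (ENNReal.ofReal p) P (ℱ (x (k + 1))))
    (hZa : ∀ k, ‖Z k‖ ≤ a * ((x (k + 1) : ℝ) - x k) ^ (1 / 2 + ε₁))
    (hZb : ∀ k, ‖condLp (ℱ (x k)) (Z k)‖ ≤ b * ((x (k + 1) : ℝ) - x k) ^ (1 + ε₂)) (n : ℕ) :
    ‖∑ k ∈ Finset.range n, Z k‖ ≤ b * (μ ^ ε₂ * ((x n : ℝ) - x 0)) +
      2 * martingaleConst p * a * (μ ^ ε₁ * √((x n : ℝ) - x 0)) := by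
  have hκ := one_le_martingaleConst hp
  have hd : ∀ k, 0 ≤ (x (k + 1) : ℝ) - x k := fun k =>
    sub_nonneg.2 (NNReal.coe_le_coe.2 (hx k.le_succ))
  have hμ0 : 0 ≤ μ := (hd 0).trans (hμ 0)
  have h := norm_sum_le_of_condLp hp ℱ hx hZm hZa hZb n
  have h1 : ∑ k ∈ Finset.range n, b * ((x (k + 1) : ℝ) - x k) ^ (1 + ε₂) ≤
      b * (μ ^ ε₂ * ((x n : ℝ) - x 0)) := by
    rw [← Finset.mul_sum]
    exact mul_le_mul_of_nonneg_left (sum_rpow_one_add_le hx hε₂ hμ n) hb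
  have h2 : ∑ k ∈ Finset.range n, (a * ((x (k + 1) : ℝ) - x k) ^ (1 / 2 + ε₁)) ^ 2 ≤
      (a * μ ^ ε₁) ^ 2 * ((x n : ℝ) - x 0) := by
    have e : ∀ k, (a * ((x (k + 1) : ℝ) - x k) ^ (1 / 2 + ε₁)) ^ 2 =
        a ^ 2 * ((x (k + 1) : ℝ) - x k) ^ (1 + 2 * ε₁) := fun k => by
      rw [mul_pow, ← Real.rpow_mul_natCast (hd k)]
      congr 2; push_cast; ring
    simp only [e]
    have e' : (μ ^ ε₁) ^ 2 = μ ^ (2 * ε₁) := by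
      rw [← Real.rpow_mul_natCast hμ0, mul_comm]; norm_cast
    rw [← Finset.mul_sum, mul_pow, mul_assoc, e']
    exact mul_le_mul_of_nonneg_left
      (sum_rpow_one_add_le hx (by positivity : 0 ≤ 2 * ε₁) hμ n) (by positivity)
  have h3 := Real.sqrt_le_sqrt h2
  rw [Real.sqrt_mul (by positivity), Real.sqrt_sq (by positivity)] at h3
  have h4 := mul_le_mul_of_nonneg_left h3 (by positivity : 0 ≤ 2 * martingaleConst p)
  linarith

lemma norm_condLp_sum_le_of_rpow (ℱ : Filtration ℝ≥0 mΩ) {x : ℕ → ℝ≥0} (hx : Monotone x)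
    {Z : ℕ → Lp E (ENNReal.ofReal p) P} {b ε₂ μ : ℝ} (hε₂ : 0 ≤ ε₂)
    (hb : 0 ≤ b) (hμ : ∀ k, (x (k + 1) : ℝ) - x k ≤ μ)
    (hZb : ∀ k, ‖condLp (ℱ (x k)) (Z k)‖ ≤ b * ((x (k + 1) : ℝ) - x k) ^ (1 + ε₂)) (n : ℕ) :
    ‖condLp (ℱ (x 0)) (∑ k ∈ Finset.range n, Z k)‖ ≤ b * (μ ^ ε₂ * ((x n : ℝ) - x 0)) := by
  rw [map_sum]
  refine (norm_sum_le _ _).trans ?_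
  refine (Finset.sum_le_sum fun k _ => (norm_condLp_le_norm_condLp (ℱ.mono (hx k.zero_le))
    (ℱ.le _) (Z k)).trans (hZb k)).trans ?_
  rw [← Finset.mul_sum]
  exact mul_le_mul_of_nonneg_left (sum_rpow_one_add_le hx hε₂ hμ n) hb

end

/-! ### Convergence of the dyadic sums -/

section

variable {Ω : Type*} {mΩ : MeasurableSpace Ω} {E : Type*} [NormedAddCommGroup E]
  [InnerProductSpace ℝ E] [FiniteDimensional ℝ E] {P : Measure Ω} [IsProbabilityMeasure P]
  {p : ℝ} [Fact (1 ≤ ENNReal.ofReal p)]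

/-- The hypotheses of the stochastic sewing lemma for `A` on `[S, 1]^*_≤`, with the weights absorbed
into the constants `a` and `b`. -/
structure SewingData (ℱ : Filtration ℝ≥0 mΩ) (A : ℝ≥0 → ℝ≥0 → Lp E (ENNReal.ofReal p) P)
    (ε₁ ε₂ a b : ℝ) (S : ℝ≥0) : Prop where
  a_nonneg : 0 ≤ a
  b_nonneg : 0 ≤ b
  ε₁_pos : 0 < ε₁
  ε₂_pos : 0 < ε₂
  adapted : ∀ s t : ℝ≥0, 0 < s → s < t → t ≤ 1 →
    A s t ∈ measurableLp E (ENNReal.ofReal p) P (ℱ t)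
  norm_le : ∀ s t : ℝ≥0, (s, t) ∈ starPairs S → ‖A s t‖ ≤ a * ((t : ℝ) - s) ^ (1 / 2 + ε₁)
  condLp_le : ∀ s t : ℝ≥0, (s, t) ∈ starPairs S → ∀ u : ℝ≥0, s < u → u < t →
    ‖condLp (ℱ s) (sewDelta A s u t)‖ ≤ b * ((t : ℝ) - s) ^ (1 + ε₂)

variable {ℱ : Filtration ℝ≥0 mΩ} {A : ℝ≥0 → ℝ≥0 → Lp E (ENNReal.ofReal p) P}
  {ε₁ ε₂ a b : ℝ} {S : ℝ≥0}

lemma starPairs_of_le {s t x y : ℝ≥0} (h : (s, t) ∈ starPairs S) (hs : s ≤ x) (hxy : x < y)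
    (hy : y ≤ t) : (x, y) ∈ starPairs S := by
  obtain ⟨h1, _, h3, h4⟩ := h
  refine ⟨h1.trans_le hs, hxy, hy.trans h3, ?_⟩
  have := NNReal.coe_le_coe.2 hs
  have := NNReal.coe_le_coe.2 hy
  dsimp only at h4 ⊢
  linarith

namespace SewingData

lemma strictPart_mem (h : SewingData ℱ A ε₁ ε₂ a b S) {s t : ℝ≥0} (hs : 0 < s) (ht : t ≤ 1) :
    strictPart A s t ∈ measurableLp E (ENNReal.ofReal p) P (ℱ t) := by
  unfold strictPart
  split_ifs with hst
  · exact h.adapted s t hs hst ht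
  · exact AddSubgroup.zero_mem _

lemma sewDelta_mem (h : SewingData ℱ A ε₁ ε₂ a b S) {s u t : ℝ≥0} (hs : 0 < s) (hsu : s ≤ u)
    (hut : u ≤ t) (ht : t ≤ 1) :
    sewDelta (strictPart A) s u t ∈ measurableLp E (ENNReal.ofReal p) P (ℱ t) :=
  AddSubgroup.sub_mem _ (AddSubgroup.sub_mem _ (h.strictPart_mem hs ht)
    (measurableLp_mono (ℱ.mono hut) (h.strictPart_mem hs (hut.trans ht))))
    (h.strictPart_mem (hs.trans_le hsu) ht)

lemma norm_sewDelta_le (h : SewingData ℱ A ε₁ ε₂ a b S) {s u t : ℝ≥0} (hS : S < s)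
    (hsu : s ≤ u) (hut : u ≤ t) (ht : t ≤ 1) (hst : (t : ℝ) - s ≤ S) :
    ‖sewDelta (strictPart A) s u t‖ ≤ 3 * a * ((t : ℝ) - s) ^ (1 / 2 + ε₁) := by
  have ha := h.a_nonneg
  have he := h.ε₁_pos
  have h0 : 0 ≤ (t : ℝ) - s := sub_nonneg.2 (NNReal.coe_le_coe.2 (hsu.trans hut))
  rcases hsu.eq_or_lt with rfl | hsu'
  · rw [sewDelta_strictPart_left, norm_zero]; positivity
  rcases hut.eq_or_lt with rfl | hut'
  · rw [sewDelta_strictPart_right, norm_zero]; positivity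
  have hp : (s, t) ∈ starPairs S := ⟨hS, hsu'.trans hut', ht, hst⟩
  rw [sewDelta_strictPart A hsu' hut', sewDelta]
  have h1 := h.norm_le s t hp
  have h2 := h.norm_le s u (starPairs_of_le hp le_rfl hsu' hut)
  have h3 := h.norm_le u t (starPairs_of_le hp hsu hut' le_rfl)
  have hsu'' := NNReal.coe_le_coe.2 hsu
  have hut'' := NNReal.coe_le_coe.2 hut
  have h4 : ((u : ℝ) - s) ^ (1 / 2 + ε₁) ≤ ((t : ℝ) - s) ^ (1 / 2 + ε₁) :=
    Real.rpow_le_rpow (by linarith) (by linarith) (by positivity)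
  have h5 : ((t : ℝ) - u) ^ (1 / 2 + ε₁) ≤ ((t : ℝ) - s) ^ (1 / 2 + ε₁) :=
    Real.rpow_le_rpow (by linarith) (by linarith) (by positivity)
  have h6 := mul_le_mul_of_nonneg_left h4 ha
  have h7 := mul_le_mul_of_nonneg_left h5 ha
  have h8 := norm_sub_le (A s t - A s u) (A u t)
  have h9 := norm_sub_le (A s t) (A s u)
  linarith

lemma norm_condLp_sewDelta_le (h : SewingData ℱ A ε₁ ε₂ a b S) {s u t : ℝ≥0} (hS : S < s)
    (hsu : s ≤ u) (hut : u ≤ t) (ht : t ≤ 1) (hst : (t : ℝ) - s ≤ S) :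
    ‖condLp (ℱ s) (sewDelta (strictPart A) s u t)‖ ≤ b * ((t : ℝ) - s) ^ (1 + ε₂) := by
  have hb := h.b_nonneg
  have h0 : 0 ≤ (t : ℝ) - s := sub_nonneg.2 (NNReal.coe_le_coe.2 (hsu.trans hut))
  rcases hsu.eq_or_lt with rfl | hsu'
  · rw [sewDelta_strictPart_left, map_zero, norm_zero]; positivity
  rcases hut.eq_or_lt with rfl | hut'
  · rw [sewDelta_strictPart_right, map_zero, norm_zero]; positivity
  rw [sewDelta_strictPart A hsu' hut']
  exact h.condLp_le s t ⟨hS, hsu'.trans hut', ht, hst⟩ u hsu' hut'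

/-- Inserting one point `w k` into each interval of a partition changes the sum of `A` by an amount
controlled by the mesh `μ` and by the total length. -/
lemma norm_sum_sewDelta_le (hp : 2 ≤ p) (h : SewingData ℱ A ε₁ ε₂ a b S) {x w : ℕ → ℝ≥0} {μ : ℝ}
    (hx : Monotone x) (hS : S < x 0) (hx1 : ∀ k, x k ≤ 1) (hxS : ∀ k, (x (k + 1) : ℝ) - x k ≤ S)
    (hμ : ∀ k, (x (k + 1) : ℝ) - x k ≤ μ) (hxw : ∀ k, x k ≤ w k) (hwx : ∀ k, w k ≤ x (k + 1))
    (n : ℕ) :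
    ‖∑ k ∈ Finset.range n, sewDelta (strictPart A) (x k) (w k) (x (k + 1))‖ ≤
        b * (μ ^ ε₂ * ((x n : ℝ) - x 0)) +
          6 * martingaleConst p * a * (μ ^ ε₁ * √((x n : ℝ) - x 0)) ∧
      ‖condLp (ℱ (x 0)) (∑ k ∈ Finset.range n, sewDelta (strictPart A) (x k) (w k) (x (k + 1)))‖ ≤
        b * (μ ^ ε₂ * ((x n : ℝ) - x 0)) := by
  have hS' : ∀ k, S < x k := fun k => hS.trans_le (hx k.zero_le)
  have hb : ∀ k, ‖condLp (ℱ (x k)) (sewDelta (strictPart A) (x k) (w k) (x (k + 1)))‖ ≤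
      b * ((x (k + 1) : ℝ) - x k) ^ (1 + ε₂) := fun k =>
    h.norm_condLp_sewDelta_le (hS' k) (hxw k) (hwx k) (hx1 _) (hxS k)
  refine ⟨?_, norm_condLp_sum_le_of_rpow ℱ hx h.ε₂_pos.le h.b_nonneg hμ hb n⟩
  refine (norm_sum_le_of_rpow hp ℱ hx h.ε₁_pos.le h.ε₂_pos.le
    (mul_nonneg zero_le_three h.a_nonneg) h.b_nonneg hμ
    (fun k => h.sewDelta_mem (pos_of_gt (hS' k)) (hxw k) (hwx k) (hx1 _))
    (fun k => h.norm_sewDelta_le (hS' k) (hxw k) (hwx k) (hx1 _) (hxS k)) hb n).trans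
    (le_of_eq ?_)
  ring

lemma norm_gridSum_sub_succ_le (hp : 2 ≤ p) (h : SewingData ℱ A ε₁ ε₂ a b S) {s t : ℝ≥0}
    (hS : S < s) (hst : s ≤ t) (ht : t ≤ 1) (n : ℕ)
    (hn : (t : ℝ) - s ≤ S ∨ ((2 : ℝ) ^ n)⁻¹ ≤ S) :
    ‖gridSum A n s t - gridSum A (n + 1) s t‖ ≤
        b * (((2 : ℝ) ^ n)⁻¹ ^ ε₂ * ((t : ℝ) - s)) +
          6 * martingaleConst p * a * (((2 : ℝ) ^ n)⁻¹ ^ ε₁ * √((t : ℝ) - s)) ∧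
      ‖condLp (ℱ s) (gridSum A n s t - gridSum A (n + 1) s t)‖ ≤
        b * (((2 : ℝ) ^ n)⁻¹ ^ ε₂ * ((t : ℝ) - s)) := by
  have hx0 := clampGrid_zero s t n
  have hxn := clampGrid_two_pow hst ht n
  have hmesh : ∀ k, (clampGrid s t n (k + 1) : ℝ) - clampGrid s t n k ≤ S := fun k => by
    rcases hn with hn | hn
    · have h1 := NNReal.coe_le_coe.2 (clampGrid_le hst n (k + 1))
      have h2 := NNReal.coe_le_coe.2 (le_clampGrid s t n k)
      linarith
    · exact (clampGrid_succ_sub_le s t n k).trans hn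
  have := h.norm_sum_sewDelta_le hp (clampGrid_mono s t n) (by rwa [hx0])
    (fun k => (clampGrid_le hst n k).trans ht) hmesh (clampGrid_succ_sub_le s t n)
    (w := fun k => clampGrid s t (n + 1) (2 * k + 1))
    (fun k => (clampGrid_succ_two_mul s t n k).symm.trans_le
      (clampGrid_mono s t (n + 1) (Nat.le_succ _)))
    (fun k => (clampGrid_mono s t (n + 1) (by omega : 2 * k + 1 ≤ 2 * (k + 1))).trans_eq
      (clampGrid_succ_two_mul s t n (k + 1)))
    (2 ^ n)
  rw [hx0, hxn] at this
  rw [gridSum_sub_gridSum_succ]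
  exact this

lemma norm_gridSum_sub_split_le (hp : 2 ≤ p) (h : SewingData ℱ A ε₁ ε₂ a b S) {s u t : ℝ≥0}
    (hS : S < s) (hsu : s ≤ u) (hut : u ≤ t) (ht : t ≤ 1) (n : ℕ) (hn : ((2 : ℝ) ^ n)⁻¹ ≤ S) :
    ‖gridSum A n s t - gridSum A n s u - gridSum A n u t‖ ≤
      b * (((2 : ℝ) ^ n)⁻¹ ^ ε₂ * ((t : ℝ) - s)) +
        6 * martingaleConst p * a * (((2 : ℝ) ^ n)⁻¹ ^ ε₁ * √((t : ℝ) - s)) := by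
  have hx0 := clampGrid_zero s t n
  have hxn := clampGrid_two_pow (hsu.trans hut) ht n
  have := (h.norm_sum_sewDelta_le hp (clampGrid_mono s t n) (by rwa [hx0])
    (fun k => (clampGrid_le (hsu.trans hut) n k).trans ht)
    (fun k => (clampGrid_succ_sub_le s t n k).trans hn) (clampGrid_succ_sub_le s t n)
    (w := fun k => max (clampGrid s t n k) (min u (clampGrid s t n (k + 1))))
    (fun k => le_max_left _ _)
    (fun k => max_le (clampGrid_mono s t n k.le_succ) (min_le_right _ _)) (2 ^ n)).1
  rw [hx0, hxn] at this
  rw [gridSum_sub_split A n hsu hut]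
  exact this

lemma gridSum_mem (h : SewingData ℱ A ε₁ ε₂ a b S) {s t : ℝ≥0} (hs : 0 < s) (hst : s ≤ t)
    (ht : t ≤ 1) (n : ℕ) : gridSum A n s t ∈ measurableLp E (ENNReal.ofReal p) P (ℱ t) :=
  AddSubgroup.sum_mem _ fun _ _ => measurableLp_mono (ℱ.mono (clampGrid_le hst _ _))
    (h.strictPart_mem (hs.trans_le (le_clampGrid _ _ _ _)) ((clampGrid_le hst _ _).trans ht))

end SewingData

/-- The ratio `2 ^ (-ε)` of the successive errors of dyadic sums. -/
noncomputable def dyadicRatio (ε : ℝ) : ℝ := (2 : ℝ)⁻¹ ^ ε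

lemma dyadicRatio_pos (ε : ℝ) : 0 < dyadicRatio ε := Real.rpow_pos_of_pos (by norm_num) _

lemma dyadicRatio_lt_one {ε : ℝ} (hε : 0 < ε) : dyadicRatio ε < 1 :=
  Real.rpow_lt_one (by norm_num) (by norm_num) hε

lemma inv_two_pow_rpow (ε : ℝ) (n : ℕ) : ((2 : ℝ) ^ n)⁻¹ ^ ε = dyadicRatio ε ^ n := by
  rw [dyadicRatio, ← inv_pow, ← Real.rpow_natCast, ← Real.rpow_mul (by norm_num), mul_comm,
    Real.rpow_mul (by norm_num), Real.rpow_natCast]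

/-- A sequence whose increments are bounded by a sum of two geometric sequences. -/
lemma norm_sub_le_of_geometric {V : Type*} [NormedAddCommGroup V] {f : ℕ → V} {l : V}
    {c₁ c₂ r₁ r₂ : ℝ} (h₁ : 0 ≤ r₁) (h₁' : r₁ < 1) (h₂ : 0 ≤ r₂) (h₂' : r₂ < 1)
    (hf : ∀ n, ‖f n - f (n + 1)‖ ≤ c₁ * r₁ ^ n + c₂ * r₂ ^ n) (hl : Tendsto f atTop (𝓝 l)) :
    ‖l - f 0‖ ≤ c₁ / (1 - r₁) + c₂ / (1 - r₂) := by
  have hs := ((hasSum_geometric_of_lt_one h₁ h₁').mul_left c₁).add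
    ((hasSum_geometric_of_lt_one h₂ h₂').mul_left c₂)
  have := dist_le_tsum_of_dist_le_of_tendsto₀ _ (fun n => (dist_eq_norm (f n) _).trans_le (hf n))
    hs.summable hl
  rwa [hs.tsum_eq, dist_comm, dist_eq_norm] at this

lemma cauchySeq_of_geometric {V : Type*} [NormedAddCommGroup V] {f : ℕ → V}
    {c₁ c₂ r₁ r₂ : ℝ} (h₁ : 0 ≤ r₁) (h₁' : r₁ < 1) (h₂ : 0 ≤ r₂) (h₂' : r₂ < 1)
    (hf : ∀ n, ‖f n - f (n + 1)‖ ≤ c₁ * r₁ ^ n + c₂ * r₂ ^ n) : CauchySeq f :=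
  cauchySeq_of_dist_le_of_summable _ (fun n => (dist_eq_norm (f n) _).trans_le (hf n))
    (((summable_geometric_of_lt_one h₁ h₁').mul_left c₁).add
      ((summable_geometric_of_lt_one h₂ h₂').mul_left c₂))

/-- The sewn increment over `[s, t]`: the limit of the dyadic sums. -/
noncomputable def sewLimit (A : ℝ≥0 → ℝ≥0 → Lp E (ENNReal.ofReal p) P) (s t : ℝ≥0) :
    Lp E (ENNReal.ofReal p) P := limUnder atTop fun n => gridSum A n s t

lemma exists_inv_two_pow_le {S : ℝ≥0} (hS : 0 < S) : ∃ n₀, ∀ n ≥ n₀, ((2 : ℝ) ^ n)⁻¹ ≤ S := by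
  obtain ⟨n₀, hn₀⟩ := exists_pow_lt_of_lt_one (NNReal.coe_pos.2 hS) (by norm_num : (2 : ℝ)⁻¹ < 1)
  refine ⟨n₀, fun n hn => ?_⟩
  rw [← inv_pow]
  exact (pow_le_pow_of_le_one (by norm_num) (by norm_num) hn).trans hn₀.le

lemma tendsto_dyadic_error {ε₁ ε₂ : ℝ} (hε₁ : 0 < ε₁) (hε₂ : 0 < ε₂) (c₁ c₂ d₁ d₂ : ℝ) :
    Tendsto (fun n : ℕ => c₂ * (((2 : ℝ) ^ n)⁻¹ ^ ε₂ * d₂) + c₁ * (((2 : ℝ) ^ n)⁻¹ ^ ε₁ * d₁))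
      atTop (𝓝 0) := by
  simp only [inv_two_pow_rpow]
  have h1 := tendsto_pow_atTop_nhds_zero_of_lt_one (dyadicRatio_pos ε₁).le (dyadicRatio_lt_one hε₁)
  have h2 := tendsto_pow_atTop_nhds_zero_of_lt_one (dyadicRatio_pos ε₂).le (dyadicRatio_lt_one hε₂)
  simpa using ((h2.mul_const d₂).const_mul c₂).add ((h1.mul_const d₁).const_mul c₁)

/-- The constant of the bound for `𝒜 - A` in the `L_p` norm. -/
noncomputable def sewConst₁ (p ε₁ : ℝ) : ℝ :=
  3 + 6 * martingaleConst p * 2 ^ ε₁ / (1 - dyadicRatio ε₁)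

/-- The constant of the bound for the conditional expectations of `𝒜 - A`. -/
noncomputable def sewConst₂ (ε₂ : ℝ) : ℝ := 1 + 2 ^ ε₂ / (1 - dyadicRatio ε₂)

namespace SewingData

lemma tendsto_gridSum (hp : 2 ≤ p) (h : SewingData ℱ A ε₁ ε₂ a b S) (hS0 : 0 < S) {s t : ℝ≥0}
    (hS : S < s) (hst : s ≤ t) (ht : t ≤ 1) :
    Tendsto (fun n => gridSum A n s t) atTop (𝓝 (sewLimit A s t)) := by
  refine CauchySeq.tendsto_limUnder ?_
  obtain ⟨n₀, hn₀⟩ := exists_inv_two_pow_le hS0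
  rw [← cauchySeq_shift n₀]
  refine cauchySeq_of_geometric
    (c₁ := 6 * martingaleConst p * a * dyadicRatio ε₁ ^ n₀ * √((t : ℝ) - s))
    (c₂ := b * dyadicRatio ε₂ ^ n₀ * ((t : ℝ) - s))
    (dyadicRatio_pos ε₁).le (dyadicRatio_lt_one h.ε₁_pos) (dyadicRatio_pos ε₂).le
    (dyadicRatio_lt_one h.ε₂_pos) fun n => ?_
  have := (h.norm_gridSum_sub_succ_le hp hS hst ht (n + n₀) (Or.inr (hn₀ _ (by omega)))).1
  rw [inv_two_pow_rpow, inv_two_pow_rpow, pow_add, pow_add] at this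
  rw [show n + 1 + n₀ = n + n₀ + 1 by ring]
  refine this.trans (le_of_eq ?_)
  ring

lemma sewLimit_add (hp : 2 ≤ p) (h : SewingData ℱ A ε₁ ε₂ a b S) (hS0 : 0 < S) {s u t : ℝ≥0}
    (hS : S < s) (hsu : s ≤ u) (hut : u ≤ t) (ht : t ≤ 1) :
    sewLimit A s u + sewLimit A u t = sewLimit A s t := by
  obtain ⟨n₀, hn₀⟩ := exists_inv_two_pow_le hS0
  have h1 := ((h.tendsto_gridSum hp hS0 hS (hsu.trans hut) ht).sub
    (h.tendsto_gridSum hp hS0 hS hsu (hut.trans ht))).sub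
    (h.tendsto_gridSum hp hS0 (hS.trans_le hsu) hut ht)
  have h2 : Tendsto (fun n => gridSum A n s t - gridSum A n s u - gridSum A n u t) atTop (𝓝 0) := by
    refine squeeze_zero_norm' ?_ (tendsto_dyadic_error h.ε₁_pos h.ε₂_pos
      (6 * martingaleConst p * a) b (√((t : ℝ) - s)) ((t : ℝ) - s))
    filter_upwards [eventually_ge_atTop n₀] with n hn
    exact h.norm_gridSum_sub_split_le hp hS hsu hut ht n (hn₀ n hn)
  have h3 := tendsto_nhds_unique h1 h2
  rw [sub_sub, sub_eq_zero] at h3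
  exact h3.symm

lemma sewLimit_mem (hp : 2 ≤ p) (h : SewingData ℱ A ε₁ ε₂ a b S) (hS0 : 0 < S) {s t : ℝ≥0}
    (hS : S < s) (hst : s ≤ t) (ht : t ≤ 1) :
    sewLimit A s t ∈ measurableLp E (ENNReal.ofReal p) P (ℱ t) :=
  (isClosed_measurableLp (ℱ.le t)).mem_of_tendsto (h.tendsto_gridSum hp hS0 hS hst ht)
    (Eventually.of_forall fun n => h.gridSum_mem (hS0.trans hS) hst ht n)

lemma sewLimit_sub_le (hp : 2 ≤ p) (h : SewingData ℱ A ε₁ ε₂ a b S) (hS0 : 0 < S) {s t : ℝ≥0}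
    (hst : (s, t) ∈ starPairs S) :
    ‖sewLimit A s t - A s t‖ ≤ sewConst₁ p ε₁ * a * ((t : ℝ) - s) ^ (1 / 2 + ε₁) +
        sewConst₂ ε₂ * b * ((t : ℝ) - s) ^ (1 + ε₂) ∧
      ‖condLp (ℱ s) (sewLimit A s t - A s t)‖ ≤
        sewConst₂ ε₂ * b * ((t : ℝ) - s) ^ (1 + ε₂) := by
  obtain ⟨hS, hlt, ht, hle⟩ := id hst
  dsimp only at hS hlt ht hle
  have ha := h.a_nonneg
  have hb := h.b_nonneg
  have hε₁ := h.ε₁_pos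
  have hε₂ := h.ε₂_pos
  have hκ := one_le_martingaleConst hp
  have hh : 0 < (t : ℝ) - s := sub_pos.2 (NNReal.coe_lt_coe.2 hlt)
  have hh1 : (t : ℝ) - s ≤ 1 := by
    have : (t : ℝ) ≤ 1 := by exact_mod_cast ht
    have := s.coe_nonneg
    linarith
  -- Comparison with `A s t` starts at the scale `2 ^ (-n₀)` of the interval.
  obtain ⟨n₀, hn₁, hn₂⟩ := exists_nat_pow_near_of_lt_one hh hh1 (by norm_num : (0 : ℝ) < 2⁻¹)
    (by norm_num)
  have hr : ∀ ε : ℝ, 0 < ε → dyadicRatio ε ^ n₀ ≤ 2 ^ ε * ((t : ℝ) - s) ^ ε := fun ε hε => by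
    rw [← inv_two_pow_rpow, ← Real.mul_rpow (by norm_num) hh.le]
    refine Real.rpow_le_rpow (by positivity) ?_ hε.le
    rw [pow_succ, inv_pow] at hn₁
    linarith
  have hr₁ := hr ε₁ hε₁
  have hr₂ := hr ε₂ hε₂
  have hd₁ : 0 < 1 - dyadicRatio ε₁ := sub_pos.2 (dyadicRatio_lt_one hε₁)
  have hd₂ : 0 < 1 - dyadicRatio ε₂ := sub_pos.2 (dyadicRatio_lt_one hε₂)
  have e₁ : ((t : ℝ) - s) ^ ε₁ * √((t : ℝ) - s) = ((t : ℝ) - s) ^ (1 / 2 + ε₁) := by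
    rw [Real.sqrt_eq_rpow, ← Real.rpow_add hh, add_comm]
  have e₂ : ((t : ℝ) - s) ^ ε₂ * ((t : ℝ) - s) = ((t : ℝ) - s) ^ (1 + ε₂) := by
    rw [Real.rpow_add hh, Real.rpow_one, mul_comm]
  set c₁ : ℝ := 6 * martingaleConst p * a * (2 ^ ε₁ * ((t : ℝ) - s) ^ (1 / 2 + ε₁)) with hc₁
  set c₂ : ℝ := b * (2 ^ ε₂ * ((t : ℝ) - s) ^ (1 + ε₂)) with hc₂
  have hg₁ : ∀ n, 6 * martingaleConst p * a *
      (((2 : ℝ) ^ (n + n₀))⁻¹ ^ ε₁ * √((t : ℝ) - s)) ≤ c₁ * dyadicRatio ε₁ ^ n := fun n => by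
    have h0 : 0 ≤ dyadicRatio ε₁ ^ n := pow_nonneg (dyadicRatio_pos ε₁).le n
    rw [inv_two_pow_rpow, pow_add, hc₁, ← e₁]
    calc _ = 6 * martingaleConst p * a * dyadicRatio ε₁ ^ n * √((t : ℝ) - s) *
          dyadicRatio ε₁ ^ n₀ := by ring
      _ ≤ 6 * martingaleConst p * a * dyadicRatio ε₁ ^ n * √((t : ℝ) - s) *
          (2 ^ ε₁ * ((t : ℝ) - s) ^ ε₁) := by gcongr
      _ = _ := by ring
  have hg₂ : ∀ n, b * (((2 : ℝ) ^ (n + n₀))⁻¹ ^ ε₂ * ((t : ℝ) - s)) ≤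
      c₂ * dyadicRatio ε₂ ^ n := fun n => by
    have h0 : 0 ≤ dyadicRatio ε₂ ^ n := pow_nonneg (dyadicRatio_pos ε₂).le n
    rw [inv_two_pow_rpow, pow_add, hc₂, ← e₂]
    calc _ = b * dyadicRatio ε₂ ^ n * ((t : ℝ) - s) * dyadicRatio ε₂ ^ n₀ := by ring
      _ ≤ b * dyadicRatio ε₂ ^ n * ((t : ℝ) - s) * (2 ^ ε₂ * ((t : ℝ) - s) ^ ε₂) := by gcongr
      _ = _ := by ring
  have hstep := fun n => h.norm_gridSum_sub_succ_le hp hS hlt.le ht (n + n₀) (Or.inl hle)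
  have hlim : Tendsto (fun n => gridSum A (n + n₀) s t) atTop (𝓝 (sewLimit A s t)) :=
    (tendsto_add_atTop_iff_nat n₀).2 (h.tendsto_gridSum hp hS0 hS hlt.le ht)
  have hJ : ‖sewLimit A s t - gridSum A n₀ s t‖ ≤
      c₁ / (1 - dyadicRatio ε₁) + c₂ / (1 - dyadicRatio ε₂) := by
    have := norm_sub_le_of_geometric (f := fun n => gridSum A (n + n₀) s t)
      (c₁ := c₁) (c₂ := c₂) (dyadicRatio_pos ε₁).le (dyadicRatio_lt_one hε₁)
      (dyadicRatio_pos ε₂).le (dyadicRatio_lt_one hε₂) (fun n => by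
        have h1 := (hstep n).1
        have h2 := hg₁ n
        have h3 := hg₂ n
        rw [show n + 1 + n₀ = n + n₀ + 1 by ring]
        linarith) hlim
    simpa using this
  have hcont : Continuous (condLp (ℱ s) : Lp E (ENNReal.ofReal p) P → _) :=
    AddMonoidHomClass.continuous_of_bound (condLp (ℱ s)) 1 fun X => by
      rw [one_mul]; exact norm_condLp_le _ X
  have hJc : ‖condLp (ℱ s) (sewLimit A s t - gridSum A n₀ s t)‖ ≤ c₂ / (1 - dyadicRatio ε₂) := by
    have := norm_sub_le_of_geometric (f := fun n => condLp (ℱ s) (gridSum A (n + n₀) s t))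
      (c₁ := 0) (c₂ := c₂) le_rfl one_pos
      (dyadicRatio_pos ε₂).le (dyadicRatio_lt_one hε₂) (fun n => by
        rw [← map_sub, show n + 1 + n₀ = n + n₀ + 1 by ring, zero_mul, zero_add]
        exact (hstep n).2.trans (hg₂ n)) ((hcont.tendsto _).comp hlim)
    simpa [map_sub] using this
  obtain ⟨u, hsu, hut, hu⟩ := exists_strictPart_sub_gridSum_eq A n₀ hlt.le ht
    (by rw [← inv_pow]; exact hn₂)
  rw [strictPart_of_lt A hlt] at hu
  have hu₁ := h.norm_sewDelta_le hS hsu hut ht hle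
  have hu₂ := h.norm_condLp_sewDelta_le hS hsu hut ht hle
  rw [← hu] at hu₁ hu₂
  have hsplit : sewLimit A s t - A s t =
      (sewLimit A s t - gridSum A n₀ s t) - (A s t - gridSum A n₀ s t) := by abel
  have hbp : 0 ≤ b * ((t : ℝ) - s) ^ (1 + ε₂) := by positivity
  have f₁ : sewConst₁ p ε₁ * a * ((t : ℝ) - s) ^ (1 / 2 + ε₁) =
      3 * a * ((t : ℝ) - s) ^ (1 / 2 + ε₁) + c₁ / (1 - dyadicRatio ε₁) := by
    rw [sewConst₁, hc₁]; field_simp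
  have f₂ : sewConst₂ ε₂ * b * ((t : ℝ) - s) ^ (1 + ε₂) =
      b * ((t : ℝ) - s) ^ (1 + ε₂) + c₂ / (1 - dyadicRatio ε₂) := by
    rw [sewConst₂, hc₂]; field_simp
  rw [f₁, f₂, hsplit, map_sub]
  constructor
  · have := norm_sub_le (sewLimit A s t - gridSum A n₀ s t) (A s t - gridSum A n₀ s t)
    linarith
  · have := norm_sub_le (condLp (ℱ s) (sewLimit A s t - gridSum A n₀ s t))
      (condLp (ℱ s) (A s t - gridSum A n₀ s t))
    linarith

end SewingData

end

/-! ### Behaviour at zero and uniqueness -/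

/-- A function on `(0, 1]` whose increments over `[s, t]`, `t ≤ 2 s`, are of order `s ^ γ` has a
limit at `0`. -/
lemma exists_tendsto_of_norm_sub_le {V : Type*} [NormedAddCommGroup V] [CompleteSpace V]
    {F : ℝ≥0 → V} {c γ : ℝ} (hc : 0 ≤ c) (hγ : 0 < γ)
    (hF : ∀ s t : ℝ≥0, 0 < s → s ≤ t → t ≤ 2 * s → t ≤ 1 → ‖F t - F s‖ ≤ c * (s : ℝ) ^ γ) :
    ∃ L, Tendsto F (𝓝[>] 0) (𝓝 L) := by
  have hr0 := dyadicRatio_pos γ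
  have hr1 := dyadicRatio_lt_one hγ
  have hd : 0 < 1 - dyadicRatio γ := by linarith
  have hmono : ∀ s t : ℝ≥0, s ≤ t → c * (s : ℝ) ^ γ ≤ c * (t : ℝ) ^ γ := fun s t h =>
    mul_le_mul_of_nonneg_left
      (Real.rpow_le_rpow s.coe_nonneg (NNReal.coe_le_coe.2 h) hγ.le) hc
  -- The constant solves `c + c' * 2 ^ (-γ) = c'`, so that halving `t` closes the induction.
  have key : ∀ k : ℕ, ∀ s t : ℝ≥0, 0 < s → s ≤ t → t ≤ 2 ^ k * s → t ≤ 1 →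
      ‖F t - F s‖ ≤ c / (1 - dyadicRatio γ) * (t : ℝ) ^ γ := by
    intro k
    induction k with
    | zero =>
      intro s t hs hst hk ht
      have : s = t := le_antisymm hst (by simpa using hk)
      rw [this, sub_self, norm_zero]
      positivity
    | succ k ih =>
      intro s t hs hst hk ht
      have htγ : 0 ≤ (t : ℝ) ^ γ := by positivity
      rcases le_total t (2 * s) with h2 | h2
      · refine (hF s t hs hst h2 ht).trans ((hmono s t hst).trans ?_)
        gcongr
        rw [le_div_iff₀ hd]
        nlinarith
      · have hs2 : s ≤ t / 2 := by rw [le_div_iff₀ (by norm_num), mul_comm]; exact h2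
        have ht2 : t / 2 ≤ t := half_le_self t.2
        have h3 := ih s (t / 2) hs hs2
          (by rw [div_le_iff₀ (by norm_num)]; rw [pow_succ] at hk; convert hk using 1; ring)
          (ht2.trans ht)
        have h4 := hF (t / 2) t (hs.trans_le hs2) ht2 (by rw [mul_div_cancel₀ _ two_ne_zero]) ht
        have h5 := hmono _ _ ht2
        have h6 : ((t / 2 : ℝ≥0) : ℝ) ^ γ = dyadicRatio γ * (t : ℝ) ^ γ := by
          rw [dyadicRatio, ← Real.mul_rpow (by norm_num) t.coe_nonneg]
          push_cast; congr 1; ring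
        rw [h6] at h3
        have h7 : c / (1 - dyadicRatio γ) * (dyadicRatio γ * (t : ℝ) ^ γ) + c * (t : ℝ) ^ γ =
            c / (1 - dyadicRatio γ) * (t : ℝ) ^ γ := by field_simp; ring
        have h8 := norm_sub_le_norm_sub_add_norm_sub (F t) (F (t / 2)) (F s)
        linarith
  have key' : ∀ s t : ℝ≥0, 0 < s → s ≤ t → t ≤ 1 →
      ‖F t - F s‖ ≤ c / (1 - dyadicRatio γ) * (t : ℝ) ^ γ := by
    intro s t hs hst ht
    obtain ⟨k, hk⟩ := pow_unbounded_of_one_lt (t / s) (by norm_num : (1 : ℝ≥0) < 2)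
    exact key k s t hs hst ((div_le_iff₀ hs).1 hk.le) ht
  set x : ℕ → ℝ≥0 := fun n => (2 : ℝ≥0)⁻¹ ^ n with hx
  have hx0 : ∀ n, 0 < x n := fun n => by positivity
  have hx1 : ∀ n, x n ≤ 1 := fun n => pow_le_one₀ (by positivity) (by norm_num)
  have hcauchy : CauchySeq fun n => F (x n) := by
    refine cauchySeq_of_geometric (c₁ := c) (c₂ := 0) hr0.le hr1 le_rfl one_pos fun n => ?_
    have h1 : x (n + 1) ≤ x n := pow_le_pow_of_le_one (by positivity) (by norm_num) n.le_succ
    refine (hF _ _ (hx0 _) h1 ?_ (hx1 _)).trans ((hmono _ _ h1).trans (le_of_eq ?_))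
    · simp only [hx, pow_succ]
      rw [mul_comm, mul_assoc]; norm_num
    · rw [zero_mul, add_zero, ← inv_two_pow_rpow]
      simp [hx]
  obtain ⟨L, hL⟩ := cauchySeq_tendsto_of_complete hcauchy
  refine ⟨L, ?_⟩
  have hxlim : Tendsto x atTop (𝓝 0) :=
    NNReal.tendsto_pow_atTop_nhds_zero_of_lt_one (by norm_num)
  have hbound : ∀ t : ℝ≥0, 0 < t → t ≤ 1 →
      ‖F t - L‖ ≤ c / (1 - dyadicRatio γ) * (t : ℝ) ^ γ := by
    intro t ht0 ht
    refine le_of_tendsto (tendsto_const_nhds.sub hL).norm ?_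
    filter_upwards [hxlim.eventually (ge_mem_nhds ht0)] with n hn
    exact key' _ _ (hx0 n) hn ht
  rw [tendsto_iff_norm_sub_tendsto_zero]
  have hlim : Tendsto (fun t : ℝ≥0 => c / (1 - dyadicRatio γ) * (t : ℝ) ^ γ) (𝓝[>] 0) (𝓝 0) := by
    have h1 : Continuous fun t : ℝ≥0 => c / (1 - dyadicRatio γ) * (t : ℝ) ^ γ :=
      continuous_const.mul (NNReal.continuous_coe.rpow_const fun _ => Or.inr hγ.le)
    have h2 := (h1.tendsto 0).mono_left (nhdsWithin_le_nhds (s := Set.Ioi 0))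
    simpa [Real.zero_rpow hγ.ne'] using h2
  refine squeeze_zero' (Eventually.of_forall fun _ => norm_nonneg _) ?_ hlim
  filter_upwards [Ioc_mem_nhdsGT (zero_lt_one (α := ℝ≥0))] with t ht
  exact hbound t ht.1 ht.2

/-- The common constant of all bounds for the sewing. -/
noncomputable def sewConst (p ε₁ ε₂ : ℝ) : ℝ := sewConst₁ p ε₁ + sewConst₂ ε₂ + 1

lemma sewConst₁_nonneg {p ε₁ : ℝ} (hp : 2 ≤ p) (hε₁ : 0 < ε₁) : 0 ≤ sewConst₁ p ε₁ := by
  have := one_le_martingaleConst hp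
  have := sub_pos.2 (dyadicRatio_lt_one hε₁)
  unfold sewConst₁; positivity

lemma sewConst₂_nonneg {ε₂ : ℝ} (hε₂ : 0 < ε₂) : 0 ≤ sewConst₂ ε₂ := by
  have := sub_pos.2 (dyadicRatio_lt_one hε₂)
  unfold sewConst₂; positivity

section

variable {Ω : Type*} {mΩ : MeasurableSpace Ω} {E : Type*} [NormedAddCommGroup E]
  [InnerProductSpace ℝ E] [FiniteDimensional ℝ E] {P : Measure Ω} [IsProbabilityMeasure P]
  {p : ℝ} [Fact (1 ≤ ENNReal.ofReal p)] {ℱ : Filtration ℝ≥0 mΩ}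

/-- An adapted process whose increments have order above `1/2` and whose conditional increments have
order above `1` is constant: the bound for the telescoping sum over a grid tends to `0`. -/
lemma eq_of_increment_bounds (hp : 2 ≤ p) {D : ℝ≥0 → Lp E (ENNReal.ofReal p) P}
    {ε₁ ε₂ a b : ℝ} {S : ℝ≥0} (hS0 : 0 < S) (ha : 0 ≤ a) (hb : 0 ≤ b) (hε₁ : 0 < ε₁) (hε₂ : 0 < ε₂)
    (hDm : ∀ t : ℝ≥0, t ≤ 1 → D t ∈ measurableLp E (ENNReal.ofReal p) P (ℱ t))
    (hD : ∀ s t : ℝ≥0, (s, t) ∈ starPairs S →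
      ‖D t - D s‖ ≤ a * ((t : ℝ) - s) ^ (1 / 2 + ε₁) + b * ((t : ℝ) - s) ^ (1 + ε₂) ∧
        ‖condLp (ℱ s) (D t - D s)‖ ≤ b * ((t : ℝ) - s) ^ (1 + ε₂))
    {s t : ℝ≥0} (hS : S < s) (hst : s ≤ t) (ht : t ≤ 1) : D t = D s := by
  set ε := min ε₁ ε₂ with hε
  have hε0 : 0 < ε := lt_min hε₁ hε₂
  obtain ⟨n₀, hn₀⟩ := exists_inv_two_pow_le hS0
  have hbound : ∀ n ≥ n₀, ‖D t - D s‖ ≤ b * (((2 : ℝ) ^ n)⁻¹ ^ ε₂ * ((t : ℝ) - s)) +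
      2 * martingaleConst p * (a + b) * (((2 : ℝ) ^ n)⁻¹ ^ ε * √((t : ℝ) - s)) := by
    intro n hn
    have hε' : 0 < 1 / 2 + ε := by positivity
    set x := clampGrid s t n with hx
    have hxm : Monotone x := clampGrid_mono s t n
    have hx1 : ∀ k, x k ≤ 1 := fun k => (clampGrid_le hst n k).trans ht
    have hpair : ∀ k, x k < x (k + 1) → (x k, x (k + 1)) ∈ starPairs S := fun k hk =>
      ⟨hS.trans_le (le_clampGrid s t n k), hk, hx1 _,
        (clampGrid_succ_sub_le s t n k).trans (hn₀ n hn)⟩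
    have h := norm_sum_le_of_rpow hp ℱ hxm (Z := fun k => D (x (k + 1)) - D (x k)) (a := a + b)
      (b := b) (ε₁ := ε) (ε₂ := ε₂) hε0.le hε₂.le (by positivity) hb
      (clampGrid_succ_sub_le s t n)
      (fun k => AddSubgroup.sub_mem _ (hDm _ (hx1 _))
        (measurableLp_mono (ℱ.mono (hxm k.le_succ)) (hDm _ (hx1 _))))
      (fun k => by
        have hd0 : 0 ≤ (x (k + 1) : ℝ) - x k := sub_nonneg.2 (NNReal.coe_le_coe.2 (hxm k.le_succ))
        have hd1 : (x (k + 1) : ℝ) - x k ≤ 1 := by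
          have : (x (k + 1) : ℝ) ≤ 1 := by exact_mod_cast hx1 (k + 1)
          have := (x k).coe_nonneg
          linarith
        rcases (hxm k.le_succ).eq_or_lt with he | hlt
        · rw [Nat.succ_eq_add_one] at he
          rw [← he, sub_self, sub_self, norm_zero]; positivity
        · refine (hD _ _ (hpair k hlt)).1.trans ?_
          rw [add_mul]
          refine add_le_add (mul_le_mul_of_nonneg_left ?_ ha) (mul_le_mul_of_nonneg_left ?_ hb)
          · exact Real.rpow_le_rpow_of_exponent_ge' hd0 hd1 (by positivity)
              (by have := min_le_left ε₁ ε₂; linarith)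
          · exact Real.rpow_le_rpow_of_exponent_ge' hd0 hd1 (by positivity)
              (by have := min_le_right ε₁ ε₂; linarith))
      (fun k => by
        rcases (hxm k.le_succ).eq_or_lt with he | hlt
        · rw [Nat.succ_eq_add_one] at he
          rw [← he, sub_self, sub_self, map_zero, norm_zero, Real.zero_rpow (by positivity),
            mul_zero]
        · exact (hD _ _ (hpair k hlt)).2) (2 ^ n)
    rw [Finset.sum_range_sub (fun k => D (x k)), hx, clampGrid_zero,
      clampGrid_two_pow hst ht] at h
    exact h
  have h0 := ge_of_tendsto (tendsto_dyadic_error hε0 hε₂ (2 * martingaleConst p * (a + b)) b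
    (√((t : ℝ) - s)) ((t : ℝ) - s)) ((eventually_ge_atTop n₀).mono hbound)
  exact sub_eq_zero.1 (norm_le_zero_iff.1 h0)

lemma sewingBounds_iff {A : ℝ≥0 → ℝ≥0 → Lp E (ENNReal.ofReal p) P}
    {𝒜 : ℝ≥0 → Lp E (ENNReal.ofReal p) P} {ε₁ ε₂ K₁ K₂ : ℝ} {S : ℝ≥0} (hK₂ : 0 ≤ K₂) :
    SewingBounds ℱ A ε₁ ε₂ 𝒜 S K₁ K₂ ↔ ∀ s t : ℝ≥0, (s, t) ∈ starPairs S →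
      ‖𝒜 t - 𝒜 s - A s t‖ ≤
          K₁ * ((t : ℝ) - s) ^ (1 / 2 + ε₁) + K₂ * ((t : ℝ) - s) ^ (1 + ε₂) ∧
        ‖condLp (ℱ s) (𝒜 t - 𝒜 s - A s t)‖ ≤ K₂ * ((t : ℝ) - s) ^ (1 + ε₂) := by
  refine forall₂_congr fun s t => imp_congr_right fun h => and_congr_right fun _ => ?_
  have h0 : 0 ≤ (t : ℝ) - s := sub_nonneg.2 (NNReal.coe_le_coe.2 h.2.1.le)
  exact condNorm_le_ofReal_iff ℱ s _ (by positivity)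

/-- Two sewings of the same `A` agree: their difference is constant on `(0, 1]` and vanishes
at `0`. -/
lemma IsSewing.eq (hp : 2 ≤ p) {A : ℝ≥0 → ℝ≥0 → Lp E (ENNReal.ofReal p) P}
    {𝒜 ℬ : ℝ≥0 → Lp E (ENNReal.ofReal p) P} {ε₁ ε₂ : ℝ} (hε₁ : 0 < ε₁) (hε₂ : 0 < ε₂)
    (h𝒜 : IsSewing ℱ A ε₁ ε₂ 𝒜) (hℬ : IsSewing ℱ A ε₁ ε₂ ℬ) {t : ℝ≥0} (ht : t ≤ 1) :
    ℬ t = 𝒜 t := by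
  rcases eq_or_ne t 0 with rfl | ht0
  · rw [h𝒜.zero, hℬ.zero]
  have ht0 : 0 < t := pos_iff_ne_zero.2 ht0
  set D : ℝ≥0 → Lp E (ENNReal.ofReal p) P := fun t => ℬ t - 𝒜 t with hDdef
  have hconst : ∀ s, 0 < s → s ≤ t → D t = D s := by
    intro s hs hst
    have hS0 : 0 < s / 2 := half_pos hs
    have hS1 : s / 2 ≤ 1 := (half_le_self s.2).trans (hst.trans ht)
    obtain ⟨K₁, K₂, hK₁, hK₂, hK⟩ := h𝒜.bounds (s / 2) hS0 hS1
    obtain ⟨M₁, M₂, hM₁, hM₂, hM⟩ := hℬ.bounds (s / 2) hS0 hS1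
    rw [sewingBounds_iff hK₂] at hK
    rw [sewingBounds_iff hM₂] at hM
    refine eq_of_increment_bounds (ℱ := ℱ) hp hS0 (a := M₁ + K₁) (b := M₂ + K₂) (by positivity)
      (by positivity) hε₁ hε₂
      (fun r hr => AddSubgroup.sub_mem _ (hℬ.adapted r hr) (h𝒜.adapted r hr))
      (fun r r' hr => ?_) (half_lt_self hs) hst ht
    obtain ⟨h1, h2⟩ := hK r r' hr
    obtain ⟨h3, h4⟩ := hM r r' hr
    have e : D r' - D r = (ℬ r' - ℬ r - A r r') - (𝒜 r' - 𝒜 r - A r r') := by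
      simp only [hDdef]; abel
    rw [e, map_sub]
    have h5 := norm_sub_le (ℬ r' - ℬ r - A r r') (𝒜 r' - 𝒜 r - A r r')
    have h6 := norm_sub_le (condLp (ℱ r) (ℬ r' - ℬ r - A r r'))
      (condLp (ℱ r) (𝒜 r' - 𝒜 r - A r r'))
    constructor <;> linarith
  have h0 : Tendsto (fun s => ‖ℬ s‖ + ‖𝒜 s‖) (𝓝[>] (0 : ℝ≥0)) (𝓝 0) := by
    simpa using hℬ.tendsto_zero.add h𝒜.tendsto_zero
  have h1 : ‖D t‖ ≤ 0 := by
    refine ge_of_tendsto h0 ?_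
    filter_upwards [Ioc_mem_nhdsGT ht0] with s hs
    rw [hconst s hs.1 hs.2]
    exact norm_sub_le _ _
  exact sub_eq_zero.1 (norm_le_zero_iff.1 h1)

lemma SewingData.norm_sewLimit_le (hp : 2 ≤ p) {A : ℝ≥0 → ℝ≥0 → Lp E (ENNReal.ofReal p) P}
    {ε₁ ε₂ a b : ℝ} {S : ℝ≥0} (h : SewingData ℱ A ε₁ ε₂ a b S) (hS0 : 0 < S) {s t : ℝ≥0}
    (hst : (s, t) ∈ starPairs S) :
    ‖sewLimit A s t‖ ≤ sewConst p ε₁ ε₂ * (a * ((t : ℝ) - s) ^ (1 / 2 + ε₁) +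
      b * ((t : ℝ) - s) ^ (1 + ε₂)) := by
  have ha := h.a_nonneg
  have hb := h.b_nonneg
  have hN₁ := sewConst₁_nonneg hp h.ε₁_pos
  have hN₂ := sewConst₂_nonneg h.ε₂_pos
  have h0 : 0 ≤ (t : ℝ) - s := sub_nonneg.2 (NNReal.coe_le_coe.2 hst.2.1.le)
  have h1 := (h.sewLimit_sub_le hp hS0 hst).1
  have h2 := h.norm_le s t hst
  have h3 := norm_add_le (sewLimit A s t - A s t) (A s t)
  rw [sub_add_cancel] at h3
  have h4 : 0 ≤ a * ((t : ℝ) - s) ^ (1 / 2 + ε₁) := by positivity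
  have h5 : 0 ≤ b * ((t : ℝ) - s) ^ (1 + ε₂) := by positivity
  have h6 := mul_nonneg hN₂ h4
  have h7 := mul_nonneg hN₁ h5
  unfold sewConst
  nlinarith

/-- The weights `S ^ (-δ₁)`, `S ^ (-δ₂)` are weaker than the orders of the increments: over `[s, t]`
with `t ≤ 2 s` the sewn increment has order `s ^ γ` with a positive `γ`. -/
lemma norm_sewLimit_le_rpow (hp : 2 ≤ p) {A : ℝ≥0 → ℝ≥0 → Lp E (ENNReal.ofReal p) P}
    {ε₁ ε₂ δ₁ δ₂ C₁ C₂ : ℝ} (hC₁ : 0 ≤ C₁) (hC₂ : 0 ≤ C₂) (hε₁ : 0 < ε₁) (hε₂ : 0 < ε₂)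
    (h₁ : 0 < 1 / 2 + ε₁ - δ₁) (h₂ : 0 < 1 + ε₂ - δ₂)
    (hA : ∀ S : ℝ≥0, 0 < S → S ≤ 1 →
      SewingData ℱ A ε₁ ε₂ (C₁ * (S : ℝ) ^ (-δ₁)) (C₂ * (S : ℝ) ^ (-δ₂)) S)
    {s t : ℝ≥0} (hs : 0 < s) (hst : s ≤ t) (hts : t ≤ 2 * s) (ht : t ≤ 1) :
    ‖sewLimit A s t‖ ≤ 2 * (sewConst p ε₁ ε₂ * (C₁ + C₂)) *
      (s : ℝ) ^ min (1 / 2 + ε₁ - δ₁) (1 + ε₂ - δ₂) := by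
  set γ := min (1 / 2 + ε₁ - δ₁) (1 + ε₂ - δ₂) with hγ
  have hγ0 : 0 < γ := lt_min h₁ h₂
  have hN : 0 ≤ sewConst p ε₁ ε₂ := by
    have := sewConst₁_nonneg hp hε₁
    have := sewConst₂_nonneg hε₂
    unfold sewConst; positivity
  have hs1 : s ≤ 1 := hst.trans ht
  have hS0 : 0 < s / 2 := half_pos hs
  have hSs : s / 2 < s := half_lt_self hs
  have hdata := hA (s / 2) hS0 (hSs.le.trans hs1)
  have hsR : 0 < (s : ℝ) := hs
  have hs1R : (s : ℝ) ≤ 1 := by exact_mod_cast hs1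
  have hstR : (s : ℝ) ≤ t := by exact_mod_cast hst
  have htsR : (t : ℝ) ≤ 2 * s := by exact_mod_cast hts
  -- On each of the two halves of `[s, t]` the hypotheses apply with `S = s / 2`.
  have piece : ∀ x y : ℝ≥0, s ≤ x → x ≤ y → y ≤ 1 → (y : ℝ) - x ≤ s / 2 →
      ‖sewLimit A x y‖ ≤ sewConst p ε₁ ε₂ * (C₁ + C₂) * (s : ℝ) ^ γ := by
    intro x y hsx hxy hy hd
    rcases hxy.eq_or_lt with rfl | hlt
    · have : sewLimit A x x = 0 := by
        have := hdata.sewLimit_add hp hS0 (hSs.trans_le hsx) le_rfl le_rfl hy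
        simpa using this
      rw [this, norm_zero]; positivity
    have hd0 : 0 ≤ (y : ℝ) - x := sub_nonneg.2 (NNReal.coe_le_coe.2 hxy)
    have h := hdata.norm_sewLimit_le hp hS0 (s := x) (t := y)
      ⟨hSs.trans_le hsx, hlt, hy, by push_cast; exact hd⟩
    refine h.trans ?_
    rw [mul_assoc (sewConst p ε₁ ε₂)]
    refine mul_le_mul_of_nonneg_left ?_ hN
    have term : ∀ C δ e : ℝ, 0 ≤ C → 0 ≤ e → γ ≤ e - δ →
        C * ((s / 2 : ℝ≥0) : ℝ) ^ (-δ) * ((y : ℝ) - x) ^ e ≤ C * (s : ℝ) ^ γ := by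
      intro C δ e hC he hγe
      have hh : 0 < (s : ℝ) / 2 := by positivity
      push_cast
      rw [mul_assoc]
      refine mul_le_mul_of_nonneg_left ?_ hC
      calc ((s : ℝ) / 2) ^ (-δ) * ((y : ℝ) - x) ^ e
          ≤ ((s : ℝ) / 2) ^ (-δ) * ((s : ℝ) / 2) ^ e := by gcongr
        _ = ((s : ℝ) / 2) ^ (e - δ) := by
            rw [← Real.rpow_add hh]; congr 1; ring
        _ ≤ (s : ℝ) ^ (e - δ) := Real.rpow_le_rpow hh.le (by linarith) (by linarith)
        _ ≤ (s : ℝ) ^ γ := Real.rpow_le_rpow_of_exponent_ge hsR hs1R hγe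
    rw [add_mul]
    exact add_le_add (term C₁ δ₁ (1 / 2 + ε₁) hC₁ (by positivity) (min_le_left _ _))
      (term C₂ δ₂ (1 + ε₂) hC₂ (by positivity) (min_le_right _ _))
  have hsu : s ≤ (s + t) / 2 := by
    rw [← NNReal.coe_le_coe]; push_cast; linarith
  have hut : (s + t) / 2 ≤ t := by
    rw [← NNReal.coe_le_coe]; push_cast; linarith
  have p1 := piece s ((s + t) / 2) le_rfl hsu (hut.trans ht) (by push_cast; linarith)
  have p2 := piece ((s + t) / 2) t hsu hut ht (by push_cast; linarith)
  rw [← hdata.sewLimit_add hp hS0 hSs hsu hut ht]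
  refine (norm_add_le _ _).trans ?_
  linarith

end

/-! ### Construction of the process -/

section

variable {Ω : Type*} {mΩ : MeasurableSpace Ω} {E : Type*} [NormedAddCommGroup E]
  [InnerProductSpace ℝ E] [FiniteDimensional ℝ E] {P : Measure Ω} [IsProbabilityMeasure P]
  {p : ℝ} [Fact (1 ≤ ENNReal.ofReal p)] {ℱ : Filtration ℝ≥0 mΩ}

/-- There is a process, adapted and continuous at `0`, whose increments are the sewn increments. -/
lemma exists_process_of_sewLimit (hp : 2 ≤ p) {A : ℝ≥0 → ℝ≥0 → Lp E (ENNReal.ofReal p) P}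
    {ε₁ ε₂ δ₁ δ₂ C₁ C₂ : ℝ} (hC₁ : 0 ≤ C₁) (hC₂ : 0 ≤ C₂) (hε₁ : 0 < ε₁) (hε₂ : 0 < ε₂)
    (h₁ : 0 < 1 / 2 + ε₁ - δ₁) (h₂ : 0 < 1 + ε₂ - δ₂)
    (hA : ∀ S : ℝ≥0, 0 < S → S ≤ 1 →
      SewingData ℱ A ε₁ ε₂ (C₁ * (S : ℝ) ^ (-δ₁)) (C₂ * (S : ℝ) ^ (-δ₂)) S) :
    ∃ 𝒜 : ℝ≥0 → Lp E (ENNReal.ofReal p) P,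
      (∀ t : ℝ≥0, t ≤ 1 → 𝒜 t ∈ measurableLp E (ENNReal.ofReal p) P (ℱ t)) ∧ 𝒜 0 = 0 ∧
      Tendsto (fun t => ‖𝒜 t‖) (𝓝[>] 0) (𝓝 0) ∧
      ∀ s t : ℝ≥0, 0 < s → s ≤ t → t ≤ 1 → 𝒜 t - 𝒜 s = sewLimit A s t := by
  have hdata : ∀ s : ℝ≥0, 0 < s → s ≤ 1 → SewingData ℱ A ε₁ ε₂
      (C₁ * ((s / 2 : ℝ≥0) : ℝ) ^ (-δ₁)) (C₂ * ((s / 2 : ℝ≥0) : ℝ) ^ (-δ₂)) (s / 2) :=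
    fun s hs hs1 => hA _ (half_pos hs) ((half_le_self s.2).trans hs1)
  set F : ℝ≥0 → Lp E (ENNReal.ofReal p) P := fun t => -sewLimit A t 1 with hF
  have hFinc : ∀ s t : ℝ≥0, 0 < s → s ≤ t → t ≤ 1 → F t - F s = sewLimit A s t := by
    intro s t hs hst ht
    have := (hdata s hs (hst.trans ht)).sewLimit_add hp (half_pos hs) (half_lt_self hs) hst ht
      le_rfl
    simp only [hF]
    rw [← this]; abel
  have hN : 0 ≤ sewConst p ε₁ ε₂ := by
    have := sewConst₁_nonneg hp hε₁
    have := sewConst₂_nonneg hε₂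
    unfold sewConst; positivity
  obtain ⟨L, hL⟩ := exists_tendsto_of_norm_sub_le (F := F)
    (c := 2 * (sewConst p ε₁ ε₂ * (C₁ + C₂))) (by positivity) (lt_min h₁ h₂)
    fun s t hs hst hts ht => by
      rw [hFinc s t hs hst ht]
      exact norm_sewLimit_le_rpow hp hC₁ hC₂ hε₁ hε₂ h₁ h₂ hA hs hst hts ht
  refine ⟨fun t => if t = 0 then 0 else F t - L, ?_, by simp, ?_, ?_⟩
  · intro t ht
    by_cases ht0 : t = 0
    · simp only [ht0, if_true]; exact AddSubgroup.zero_mem _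
    · simp only [ht0, if_false]
      have ht0' : 0 < t := pos_iff_ne_zero.2 ht0
      refine (isClosed_measurableLp (ℱ.le t)).mem_of_tendsto (tendsto_const_nhds.sub hL) ?_
      filter_upwards [Ioc_mem_nhdsGT ht0'] with s hs
      rw [hFinc s t hs.1 hs.2 ht]
      exact (hdata s hs.1 (hs.2.trans ht)).sewLimit_mem hp (half_pos hs.1)
        (half_lt_self hs.1) hs.2 ht
  · have h0 : Tendsto (fun t => ‖F t - L‖) (𝓝[>] 0) (𝓝 0) :=
      tendsto_iff_norm_sub_tendsto_zero.1 hL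
    refine h0.congr' ?_
    filter_upwards [self_mem_nhdsWithin] with t ht
    rw [if_neg (ne_of_gt ht)]
  · intro s t hs hst ht
    simp only [hs.ne', (hs.trans_le hst).ne', if_false]
    rw [← hFinc s t hs hst ht]; abel

end

theorem lemma2p9 (p ε₁ ε₂ δ₁ δ₂ : ℝ) (hp : 2 ≤ p) (hε₁ : 0 < ε₁) (hε₂ : 0 < ε₂)
    (hδ₁ : 0 ≤ δ₁) (hδ₂ : 0 ≤ δ₂) (h₁ : 0 < 1 / 2 + ε₁ - δ₁) (h₂ : 0 < 1 + ε₂ - δ₂) :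
    ∃ N : ℝ, 0 ≤ N ∧
      ∀ (Ω : Type u) (mΩ : MeasurableSpace Ω) (P : Measure Ω) [IsProbabilityMeasure P]
        (E : Type v) [NormedAddCommGroup E] [InnerProductSpace ℝ E] [FiniteDimensional ℝ E]
        (ℱ : Filtration ℝ≥0 mΩ) (A : ℝ≥0 → ℝ≥0 → Lp E (ENNReal.ofReal p) P) (C₁ C₂ : ℝ),
        0 ≤ C₁ → 0 ≤ C₂ →
        (∀ s t : ℝ≥0, 0 < s → s < t → t ≤ 1 →
          AEStronglyMeasurable[ℱ t] (A s t : Ω → E) P) →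
        (∀ S : ℝ≥0, 0 < S → S ≤ 1 → ∀ s t : ℝ≥0, (s, t) ∈ starPairs S →
          ‖A s t‖ ≤ C₁ * (S : ℝ) ^ (-δ₁) * ((t : ℝ) - s) ^ (1 / 2 + ε₁)) →
        (∀ S : ℝ≥0, 0 < S → S ≤ 1 → ∀ s t : ℝ≥0, (s, t) ∈ starPairs S →
          ∀ u : ℝ≥0, s < u → u < t →
            condNorm ℱ s (sewDelta A s u t) ≤
              ENNReal.ofReal (C₂ * (S : ℝ) ^ (-δ₂) * ((t : ℝ) - s) ^ (1 + ε₂))) →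
        ∃ 𝒜 : ℝ≥0 → Lp E (ENNReal.ofReal p) P,
          IsSewing ℱ A ε₁ ε₂ 𝒜 ∧
          (∀ ℬ : ℝ≥0 → Lp E (ENNReal.ofReal p) P,
            IsSewing ℱ A ε₁ ε₂ ℬ → ∀ t : ℝ≥0, t ≤ 1 → ℬ t = 𝒜 t) ∧
          (∀ S : ℝ≥0, 0 < S → S ≤ 1 →
            SewingBounds ℱ A ε₁ ε₂ 𝒜 S
              (N * C₁ * (S : ℝ) ^ (-δ₁)) (N * C₂ * (S : ℝ) ^ (-δ₂))) ∧
          (∀ S : ℝ≥0, 0 < S → S ≤ 1 → ∀ s t : ℝ≥0, (s, t) ∈ starPairs S →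
            ‖𝒜 t - 𝒜 s‖ ≤
              N * (C₁ * (S : ℝ) ^ (-δ₁) * ((t : ℝ) - s) ^ (1 / 2 + ε₁) +
                C₂ * (S : ℝ) ^ (-δ₂) * ((t : ℝ) - s) ^ (1 + ε₂))) := by
  have hN₁ := sewConst₁_nonneg hp hε₁
  have hN₂ := sewConst₂_nonneg hε₂
  have hN : 0 ≤ sewConst p ε₁ ε₂ := by unfold sewConst; positivity
  have hN₁' : sewConst₁ p ε₁ ≤ sewConst p ε₁ ε₂ := by unfold sewConst; linarith
  have hN₂' : sewConst₂ ε₂ ≤ sewConst p ε₁ ε₂ := by unfold sewConst; linarith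
  refine ⟨sewConst p ε₁ ε₂, hN, ?_⟩
  intro Ω mΩ P _ E _ _ _ ℱ A C₁ C₂ hC₁ hC₂ hAm hA₁ hA₂
  have : Fact (1 ≤ ENNReal.ofReal p) := ⟨ENNReal.one_le_ofReal.2 (by linarith)⟩
  have hA : ∀ S : ℝ≥0, 0 < S → S ≤ 1 →
      SewingData ℱ A ε₁ ε₂ (C₁ * (S : ℝ) ^ (-δ₁)) (C₂ * (S : ℝ) ^ (-δ₂)) S := fun S hS hS1 =>
    { a_nonneg := by positivity
      b_nonneg := by positivity
      ε₁_pos := hε₁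
      ε₂_pos := hε₂
      adapted := hAm
      norm_le := hA₁ S hS hS1
      condLp_le := fun s t hst u hsu hut => by
        have h0 : 0 ≤ (t : ℝ) - s := sub_nonneg.2 (NNReal.coe_le_coe.2 hst.2.1.le)
        exact (condNorm_le_ofReal_iff ℱ s _ (by positivity)).1 (hA₂ S hS hS1 s t hst u hsu hut) }
  obtain ⟨𝒜, hadapted, hzero, htendsto, hinc⟩ :=
    exists_process_of_sewLimit hp hC₁ hC₂ hε₁ hε₂ h₁ h₂ hA
  have hinc' : ∀ S : ℝ≥0, 0 < S → ∀ s t : ℝ≥0, (s, t) ∈ starPairs S →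
      𝒜 t - 𝒜 s = sewLimit A s t := fun S hS s t hst =>
    hinc s t (hS.trans hst.1) hst.2.1.le hst.2.2.1
  have hbounds : ∀ S : ℝ≥0, 0 < S → S ≤ 1 → SewingBounds ℱ A ε₁ ε₂ 𝒜 S
      (sewConst p ε₁ ε₂ * C₁ * (S : ℝ) ^ (-δ₁)) (sewConst p ε₁ ε₂ * C₂ * (S : ℝ) ^ (-δ₂)) := by
    intro S hS hS1
    rw [sewingBounds_iff (by positivity)]
    intro s t hst
    have h0 : 0 ≤ (t : ℝ) - s := sub_nonneg.2 (NNReal.coe_le_coe.2 hst.2.1.le)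
    obtain ⟨h1, h2⟩ := (hA S hS hS1).sewLimit_sub_le hp hS hst
    rw [hinc' S hS s t hst, mul_assoc _ C₁ ((S : ℝ) ^ (-δ₁)),
      mul_assoc _ C₂ ((S : ℝ) ^ (-δ₂))]
    constructor
    · refine h1.trans ?_
      gcongr
    · refine h2.trans ?_
      gcongr
  have hsew : IsSewing ℱ A ε₁ ε₂ 𝒜 :=
    ⟨hadapted, hzero, htendsto, fun S hS hS1 =>
      ⟨_, _, by positivity, by positivity, hbounds S hS hS1⟩⟩
  refine ⟨𝒜, hsew, fun ℬ hℬ t ht => hsew.eq hp hε₁ hε₂ hℬ ht, hbounds, fun S hS hS1 s t hst => ?_⟩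
  rw [hinc' S hS s t hst]
  exact (hA S hS hS1).norm_sewLimit_le hp hS hst
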